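/- Lemma 6.3 (Probability of small $\gamma$). Consider linear programs $\max\{cx : Ax\le b,\ x\ge 0\}$ with dual $\min\{yb : yA\ge c,\ y\ge 0\}$, where $A\in\mathbb R^{m\times n}$, $b\in\mathbb R^m$, $c\in\mathbb R^n$ and $m\ge n$. Let $\bar A,\bar b,\bar c$ satisfy $\|\bar A\|,\|\bar b\|,\|\bar c\|\le 1$ (Euclidean norm for vectors, spectral norm for matrices), let $0<\sigma^2\le 1$, and let all entries of $A,b,c$ be independent Gaussian random variables of variance $\sigma^2$ centered at the corresponding entries of $\bar A,\bar b,\bar c$. Let $\mathcal F$ be the event that the program given by $(A,b,c)$ is feasible and bounded. For optimal primal and dual solutions $x^*,y^*$ (which, on $\mathcal F$, exist and are almost surely unique) put $U=\{i:x^*_i>0\}$, $V=\{j:y^*_j>0\}$ and $$\gamma(A,b,c)=\min_{k\in U}\operatorname{dist}\bigl(A_{V,k},\operatorname{span}\{A_{V,l}:l\in U\setminus\{k\}\}\bigr),$$ where $A_{V,k}\in\mathbb R^V$ is the $k$-th column of $A$ restricted to the rows in $V$, and the minimum over the empty set is $+\infty$. Then for every $\varepsilon\ge 0$, $$\Pr_{A,b,c}\left[\gamma(A,b,c)\le\frac{\varepsilon}{(1+\|x^*\|^2+\|y^*\|^2)(\|A\|+3)}\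 \text{ and }\ \mathcal F\right]\le\frac{\varepsilon n e}{\sigma^2}.$$ (If optimal solutions are not unique, the event is understood to hold when the inequality holds for some pair of optimal solutions.) -/

import Mathlib

open MeasureTheory ProbabilityTheory
open scoped Matrix ENNReal

namespace SmoothedLP

noncomputable section

/-- The Euclidean norm `‖x‖ = √(∑ i, x i ^ 2)` of a vector given by its coordinates. -/
def vecNorm {n : ℕ} (x : Fin n → ℝ) : ℝ := ‖WithLp.toLp 2 x‖

/-- The spectral norm `‖A‖ = max_{x ≠ 0} ‖A x‖ / ‖x‖` of a matrix (Euclidean norms on both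
sides). -/
def matNorm {m n : ℕ} (A : Matrix (Fin m) (Fin n) ℝ) : ℝ :=
  ‖LinearMap.toContinuousLinearMap (Matrix.toEuclideanLin A)‖

/-! The linear program with data `(A, b, c)` is `max c x` subject to `A x ≤ b`, `x ≥ 0`;
its dual is `min y b` subject to `y A ≥ c`, `y ≥ 0`. -/

/-- `x` is a feasible point of `A x ≤ b`, `x ≥ 0`. -/
def PrimalFeasible {m n : ℕ} (A : Matrix (Fin m) (Fin n) ℝ) (b : Fin m → ℝ)
    (x : Fin n → ℝ) : Prop :=
  A *ᵥ x ≤ b ∧ 0 ≤ x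

/-- `y` is a feasible point of `y A ≥ c`, `y ≥ 0`. -/
def DualFeasible {m n : ℕ} (A : Matrix (Fin m) (Fin n) ℝ) (c : Fin n → ℝ)
    (y : Fin m → ℝ) : Prop :=
  c ≤ y ᵥ* A ∧ 0 ≤ y

/-- The linear program is feasible, and its objective function is bounded above on the
feasible set. -/
def FeasibleBounded {m n : ℕ} (A : Matrix (Fin m) (Fin n) ℝ) (b : Fin m → ℝ)
    (c : Fin n → ℝ) : Prop :=
  (∃ x, PrimalFeasible A b x) ∧ BddAbove ((fun x => c ⬝ᵥ x) '' {x | PrimalFeasible A b x})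

/-- `x` is an optimal solution of the primal program. -/
def IsPrimalOptimal {m n : ℕ} (A : Matrix (Fin m) (Fin n) ℝ) (b : Fin m → ℝ)
    (c : Fin n → ℝ) (x : Fin n → ℝ) : Prop :=
  PrimalFeasible A b x ∧ ∀ x', PrimalFeasible A b x' → c ⬝ᵥ x' ≤ c ⬝ᵥ x

/-- `y` is an optimal solution of the dual program. -/
def IsDualOptimal {m n : ℕ} (A : Matrix (Fin m) (Fin n) ℝ) (b : Fin m → ℝ)
    (c : Fin n → ℝ) (y : Fin m → ℝ) : Prop :=
  DualFeasible A c y ∧ ∀ y', DualFeasible A c y' → y ⬝ᵥ b ≤ y' ⬝ᵥ b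

/-- The set of indices at which a vector is positive: `U` for the primal solution, `V` for the
dual solution. -/
def posSupport {n : ℕ} (x : Fin n → ℝ) : Finset (Fin n) := {i | 0 < x i}

/-- The column `A_{V,k}`, as a vector of the Euclidean space `ℝ^V`. -/
def subColumn {m n : ℕ} (A : Matrix (Fin m) (Fin n) ℝ) (V : Finset (Fin m)) (k : Fin n) :
    EuclideanSpace ℝ V :=
  WithLp.toLp 2 fun j => A j k

/-- `min_{k ∈ U} dist (A_{V,k}, span A_{V,U-k})`. The value lies in `[0, ∞]`, so that the minimum
over the empty set is `∞`. -/
def gammaUV {m n : ℕ} (A : Matrix (Fin m) (Fin n) ℝ) (U : Finset (Fin n))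
    (V : Finset (Fin m)) : ℝ≥0∞ :=
  ⨅ k ∈ U, Metric.infEDist (subColumn A V k)
    (Submodule.span ℝ (subColumn A V '' ((U.erase k : Finset (Fin n)) : Set (Fin n))) :
      Set (EuclideanSpace ℝ V))

/-- The law of `(A, b, c)` when all entries are independent Gaussians of variance `σ²`, centred at
the entries of `A₀`, `b₀`, `c₀`. A matrix is recorded here as the function `i ↦ j ↦ A i j`. -/
def gaussianLP {m n : ℕ} (A₀ : Matrix (Fin m) (Fin n) ℝ) (b₀ : Fin m → ℝ) (c₀ : Fin n → ℝ)
    (σ : ℝ) : Measure ((Fin m → Fin n → ℝ) × (Fin m → ℝ) × (Fin n → ℝ)) :=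
  (Measure.pi fun i => Measure.pi fun j => gaussianReal (A₀ i j) (Real.toNNReal (σ ^ 2))).prod
    ((Measure.pi fun i => gaussianReal (b₀ i) (Real.toNNReal (σ ^ 2))).prod
      (Measure.pi fun j => gaussianReal (c₀ j) (Real.toNNReal (σ ^ 2))))

/-- The event that the program `(A, b, c)` is feasible and bounded and, for its optimal solutions
`x*` (primal) and `y*` (dual) with `U = {i | x*ᵢ > 0}` and `V = {j | y*ⱼ > 0}`,
`γ ≤ ε / ((1 + ‖x*‖² + ‖y*‖²) (‖A‖ + 3))`. If the optimal solutions are not unique, the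
inequality is only required for some pair of them, so that the event is as large as possible. -/
def smallGammaEvent (m n : ℕ) (ε : ℝ) : Set ((Fin m → Fin n → ℝ) × (Fin m → ℝ) × (Fin n → ℝ)) :=
  {p | FeasibleBounded (Matrix.of p.1) p.2.1 p.2.2 ∧
    ∃ (x : Fin n → ℝ) (y : Fin m → ℝ),
      IsPrimalOptimal (Matrix.of p.1) p.2.1 p.2.2 x ∧
      IsDualOptimal (Matrix.of p.1) p.2.1 p.2.2 y ∧
      gammaUV (Matrix.of p.1) (posSupport x) (posSupport y) ≤
        ENNReal.ofReal (ε / ((1 + vecNorm x ^ 2 + vecNorm y ^ 2) *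
          (matNorm (Matrix.of p.1) + 3)))}

end

end SmoothedLP

/-! The proof is a change of variables, carried out separately for each candidate basis: a set U of
columns and a set V of rows with |U| = |V|. Almost surely the data are nondegenerate
(`ae_nondegenerate`). Complementary slackness then forces |U| = |V| for the supports of optimal
solutions, and at most one basis is optimal (`BasisIndex.eq_of_optimal`). The events "this basis is
optimal" are therefore almost surely disjoint and have total probability at most 1. It remains to
bound, for each basis and each k in U, the probability that the basis is optimal and its column k is
bad by e ε/σ² times the probability that it is optimal. Summing over the at most n columns and over
all bases gives the claim.

For a fixed basis with square block B, let q be the unit normal to the columns other than k, and t =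
q · B_k the signed distance. With l = ε/σ² ≤ 1, multiply by l the q-components of the column and of
the right-hand side, and lower c_k by (1 - l) t (y · q). The basic solutions x and y satisfy the
same equations before and after, and nonbasic constraints are untouched, so optimality of the basis
is preserved while t becomes l t (`IsBasicSolution.of_scaled`). Each of the three maps is a rank one
perturbation of the identity with determinant l, so the substitution produces l³ ≤ l.

The Gaussian density changes by a factor of at most e as long as |t| (1 + ‖x‖² + ‖y‖²)(W + 3) ≤ σ²,
where W is the norm of the projection of B_k to the span of the other columns (`exponent_le_one`,
`densityRatio_le`). The quantity W replaces ‖A‖ because it is invariant under the scaling; since W ≤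
‖A‖, this only enlarges the event. Hence the event with threshold ε = l σ² is pulled back into the
event with threshold σ², which lies in the event that the basis is optimal
(`columnLaw_smallHeight_le`). -/

namespace SmoothedLP

/-! ### Linear programming duality and complementary slackness. -/

/-- **Farkas' lemma**: a linear functional that is nonpositive wherever finitely many functionals
are nonpositive is a nonnegative combination of them. -/
theorem farkas {ι V : Type*} [AddCommGroup V] [Module ℝ V] (s : Finset ι)
    (φ : ι → V →ₗ[ℝ] ℝ) (ψ : V →ₗ[ℝ] ℝ) (h : ∀ x, (∀ i ∈ s, φ i x ≤ 0) → ψ x ≤ 0) :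
    ∃ l : ι → ℝ, (∀ i, 0 ≤ l i) ∧ ψ = ∑ i ∈ s, l i • φ i := by
  classical
  induction s using Finset.induction_on generalizing φ ψ with
  | empty =>
    refine ⟨0, fun _ => le_rfl, LinearMap.ext fun x => ?_⟩
    have h1 := h x (by simp)
    have h2 := h (-x) (by simp)
    simp only [map_neg] at h2
    simp only [Finset.sum_empty, LinearMap.zero_apply]
    linarith
  | insert a s ha ih =>
    by_cases hs : ∀ x, (∀ i ∈ s, φ i x ≤ 0) → ψ x ≤ 0
    · obtain ⟨l, hl, e⟩ := ih φ ψ hs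
      refine ⟨Function.update l a 0, fun i => ?_, ?_⟩
      · rcases eq_or_ne i a with rfl | hi
        · simp
        · simpa [hi] using hl i
      · rw [Finset.sum_insert ha, e]
        simp only [Function.update_self, zero_smul, zero_add]
        refine Finset.sum_congr rfl fun i hi => ?_
        rw [Function.update_of_ne (by rintro rfl; exact ha hi)]
    · push Not at hs
      obtain ⟨x, hx, hψ⟩ := hs
      have hpos : 0 < φ a x := by
        by_contra hn
        refine absurd (h x fun i hi => ?_) (not_le.2 hψ)
        rcases Finset.mem_insert.1 hi with rfl | hi
        · exact not_lt.1 hn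
        · exact hx i hi
      -- Induct on the functionals composed with the projection z ↦ z - (φ_a z / φ_a x) x onto the
      -- kernel of φ_a. There the constraint a holds with equality, so `h` applies.
      obtain ⟨l, hl, e⟩ := ih (fun i => φ i - (φ i x / φ a x) • φ a)
        (ψ - (ψ x / φ a x) • φ a) (fun z hz => by
          have := h (z - (φ a z / φ a x) • x) (fun i hi => by
            rcases Finset.mem_insert.1 hi with rfl | hi
            · simp [hpos.ne']
            · have := hz i hi
              simp only [LinearMap.sub_apply, LinearMap.smul_apply, smul_eq_mul, map_sub,
                map_smul] at this ⊢
              have e : φ a z / φ a x * φ i x = φ i x / φ a x * φ a z := by ring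
              rwa [e])
          simp only [LinearMap.sub_apply, LinearMap.smul_apply, smul_eq_mul, map_sub,
            map_smul] at this ⊢
          have e : φ a z / φ a x * ψ x = ψ x / φ a x * φ a z := by ring
          rwa [← e])
      -- This is the multiplier of φ_a after undoing the projection; it is nonnegative because φ_i x
      -- ≤ 0 on s while ψ x and φ_a x are positive.
      have hc : 0 ≤ ψ x / φ a x - ∑ i ∈ s, l i * (φ i x / φ a x) := by
        have : ∑ i ∈ s, l i * (φ i x / φ a x) ≤ 0 := Finset.sum_nonpos fun i hi =>
          mul_nonpos_of_nonneg_of_nonpos (hl i) (div_nonpos_of_nonpos_of_nonneg (hx i hi) hpos.le)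
        have := div_pos hψ hpos
        linarith
      refine ⟨Function.update l a (ψ x / φ a x - ∑ i ∈ s, l i * (φ i x / φ a x)), fun i => ?_, ?_⟩
      · rcases eq_or_ne i a with rfl | hi
        · simpa using hc
        · simpa [hi] using hl i
      · rw [Finset.sum_insert ha]
        have e' : ∑ i ∈ s, Function.update l a
            (ψ x / φ a x - ∑ i ∈ s, l i * (φ i x / φ a x)) i • φ i = ∑ i ∈ s, l i • φ i :=
          Finset.sum_congr rfl fun i hi => by
            rw [Function.update_of_ne (by rintro rfl; exact ha hi)]
        rw [e', Function.update_self]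
        rw [sub_eq_iff_eq_add] at e
        refine e.trans ?_
        refine LinearMap.ext fun z => ?_
        simp only [LinearMap.add_apply, LinearMap.sum_apply, LinearMap.smul_apply,
          LinearMap.sub_apply, smul_eq_mul, mul_sub, Finset.sum_sub_distrib, sub_mul,
          Finset.sum_mul, mul_assoc]
        ring

variable {m n : ℕ} {A : Matrix (Fin m) (Fin n) ℝ} {b : Fin m → ℝ} {c : Fin n → ℝ}

theorem weak_duality {x : Fin n → ℝ} {y : Fin m → ℝ} (hx : PrimalFeasible A b x)
    (hy : DualFeasible A c y) : c ⬝ᵥ x ≤ y ⬝ᵥ b :=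
  calc c ⬝ᵥ x ≤ (y ᵥ* A) ⬝ᵥ x := dotProduct_le_dotProduct_of_nonneg_right hy.1 hx.2
    _ = y ⬝ᵥ (A *ᵥ x) := (Matrix.dotProduct_mulVec _ _ _).symm
    _ ≤ y ⬝ᵥ b := dotProduct_le_dotProduct_of_nonneg_left hx.1 hy.2

/-- Homogenize: on the cone A z ≤ t b, z ≥ 0, t ≥ 0 the functional c · z - t (c · x) is nonpositive,
by optimality of x. The Farkas multipliers of the rows A z ≤ t b form a dual feasible point of value
at most c · x. -/
theorem strong_duality {x : Fin n → ℝ} {y : Fin m → ℝ} (hx : IsPrimalOptimal A b c x)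
    (hy : IsDualOptimal A b c y) : y ⬝ᵥ b ≤ c ⬝ᵥ x := by
  classical
  obtain ⟨⟨hx1, hx0⟩, hxo⟩ := hx
  let X : ((Fin n → ℝ) × ℝ) →ₗ[ℝ] (Fin n → ℝ) := LinearMap.fst ℝ _ _
  let S : ((Fin n → ℝ) × ℝ) →ₗ[ℝ] ℝ := LinearMap.snd ℝ _ _
  let φ : (Fin m ⊕ Fin n) ⊕ Unit → ((Fin n → ℝ) × ℝ) →ₗ[ℝ] ℝ :=
    Sum.elim (Sum.elim
      (fun j => (LinearMap.proj j ∘ₗ Matrix.mulVecLin A) ∘ₗ X - b j • S)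
      (fun i => -(LinearMap.proj i ∘ₗ X))) (fun _ => -S)
  let C : (Fin n → ℝ) →ₗ[ℝ] ℝ := dotProductBilin ℝ ℝ c
  obtain ⟨l, hl, e⟩ := farkas Finset.univ φ (C ∘ₗ X - (c ⬝ᵥ x) • S) (by
    rintro ⟨z, t⟩ h
    have h1 : ∀ j, (A *ᵥ z) j ≤ b j * t := fun j => by
      have := h (.inl (.inl j)) (Finset.mem_univ _)
      simpa [φ, X, S] using this
    have h2 : 0 ≤ z := fun i => by
      have := h (.inl (.inr i)) (Finset.mem_univ _)
      simpa [φ, X, S] using this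
    have h3 : 0 ≤ t := by
      have := h (.inr ()) (Finset.mem_univ _)
      simpa [φ, X, S] using this
    suffices c ⬝ᵥ z ≤ c ⬝ᵥ x * t by simpa [C, X, S] using this
    -- For t = 0 the vector z is a recession direction, and x + z is compared with x; for t > 0 the
    -- feasible point z / t is.
    rcases h3.eq_or_lt with rfl | ht
    · have := hxo (x + z) ⟨?_, add_nonneg hx0 h2⟩
      · rw [dotProduct_add] at this
        linarith
      · intro j
        have := h1 j
        have := hx1 j
        simp only [Matrix.mulVec_add, Pi.add_apply]
        linarith
    · have := hxo (t⁻¹ • z) ⟨?_, smul_nonneg (by positivity) h2⟩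
      · rw [dotProduct_smul, smul_eq_mul, inv_mul_le_iff₀ ht] at this
        linarith
      · intro j
        rw [Matrix.mulVec_smul, Pi.smul_apply, smul_eq_mul, inv_mul_le_iff₀ ht]
        linarith [h1 j])
  have e1 : ∀ z t, c ⬝ᵥ z - c ⬝ᵥ x * t = (∑ j, l (.inl (.inl j)) * ((A *ᵥ z) j - b j * t))
      - (∑ i, l (.inl (.inr i)) * z i) - l (.inr ()) * t := fun z t => by
    have := LinearMap.congr_fun e (z, t)
    simp only [Fintype.sum_sum_type] at this
    simpa [C, X, S, φ, sub_eq_add_neg, mul_add] using this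
  have hy' := hy.2 (fun j => l (.inl (.inl j))) ⟨fun i => ?_, fun j => hl _⟩
  -- Testing the identity at (0, 1) gives the objective value; testing at the unit vectors with t =
  -- 0 gives dual feasibility.
  · refine hy'.trans ?_
    have := e1 0 1
    have h0 := hl (.inr ())
    simp [Matrix.mulVec_zero] at this
    simp only [dotProduct]
    simp only [dotProduct] at this
    linarith
  · have := e1 (Pi.single i 1) 0
    have h0 := hl (.inl (.inr i))
    simp [Pi.single_apply] at this
    simp only [Matrix.vecMul, dotProduct]
    linarith

theorem vecMul_eq_of_duality {x : Fin n → ℝ} {y : Fin m → ℝ} (hx : PrimalFeasible A b x)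
    (hy : DualFeasible A c y) (h : y ⬝ᵥ b ≤ c ⬝ᵥ x) {i : Fin n} (hi : 0 < x i) :
    (y ᵥ* A) i = c i := by
  have h1 : (y ᵥ* A) ⬝ᵥ x ≤ y ⬝ᵥ b := by
    rw [← Matrix.dotProduct_mulVec]
    exact dotProduct_le_dotProduct_of_nonneg_left hx.1 hy.2
  have h2 : ∑ i, ((y ᵥ* A) i - c i) * x i ≤ 0 := by
    have : (y ᵥ* A - c) ⬝ᵥ x ≤ 0 := by rw [sub_dotProduct]; linarith
    simpa [dotProduct] using this
  have h3 : ∀ i ∈ Finset.univ, 0 ≤ ((y ᵥ* A) i - c i) * x i := fun i _ =>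
    mul_nonneg (sub_nonneg.2 (hy.1 i)) (hx.2 i)
  have := (Finset.sum_eq_zero_iff_of_nonneg h3).1 (le_antisymm h2 (Finset.sum_nonneg h3)) i
    (Finset.mem_univ _)
  rcases mul_eq_zero.1 this with h | h
  · linarith
  · exact absurd h hi.ne'

theorem mulVec_eq_of_duality {x : Fin n → ℝ} {y : Fin m → ℝ} (hx : PrimalFeasible A b x)
    (hy : DualFeasible A c y) (h : y ⬝ᵥ b ≤ c ⬝ᵥ x) {j : Fin m} (hj : 0 < y j) :
    (A *ᵥ x) j = b j := by
  have h1 : c ⬝ᵥ x ≤ y ⬝ᵥ (A *ᵥ x) := by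
    rw [Matrix.dotProduct_mulVec]
    exact dotProduct_le_dotProduct_of_nonneg_right hy.1 hx.2
  have h2 : ∑ j, y j * (b j - (A *ᵥ x) j) ≤ 0 := by
    have : y ⬝ᵥ (b - A *ᵥ x) ≤ 0 := by rw [dotProduct_sub]; linarith
    simpa [dotProduct] using this
  have h3 : ∀ j ∈ Finset.univ, 0 ≤ y j * (b j - (A *ᵥ x) j) := fun j _ =>
    mul_nonneg (hy.2 j) (sub_nonneg.2 (hx.1 j))
  have := (Finset.sum_eq_zero_iff_of_nonneg h3).1 (le_antisymm h2 (Finset.sum_nonneg h3)) j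
    (Finset.mem_univ _)
  rcases mul_eq_zero.1 this with h | h
  · exact absurd h hj.ne'
  · linarith

end SmoothedLP

/-! ### Gaussian vectors: densities and linear substitutions. -/

namespace SmoothedLP

/-- Both sides are curried forms of one product measure over pairs of indices. Passing to
`Measure.infinitePi` gives access to its currying and reindexing lemmas. -/
theorem map_flip_pi_pi {ι κ X : Type*} [Fintype ι] [Fintype κ] [MeasurableSpace X]
    (μ : ι → κ → Measure X) [∀ i j, IsProbabilityMeasure (μ i j)] :
    (Measure.pi fun j => Measure.pi fun i => μ i j).map (fun h i j => h j i) =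
      Measure.pi fun i => Measure.pi fun j => μ i j := by
  have hm : Measurable (fun (h : κ → ι → X) i j => h j i) := by fun_prop
  have h2 : Measurable (fun (h : κ × ι → X) (p : ι × κ) => h (p.2, p.1)) := by fun_prop
  simp_rw [← Measure.infinitePi_eq_pi]
  rw [← (MeasurableEquiv.curry ι κ X).symm.map_measurableEquiv_injective.eq_iff,
    Measure.infinitePi_map_curry_symm, Measure.map_map (by fun_prop) hm]
  have e1 : (MeasurableEquiv.curry ι κ X).symm ∘ (fun (h : κ → ι → X) i j => h j i) =
      (fun (h : κ × ι → X) (p : ι × κ) => h (p.2, p.1)) ∘ (MeasurableEquiv.curry κ ι X).symm := by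
    ext h p; rfl
  rw [e1, ← Measure.map_map h2 (by fun_prop),
    Measure.infinitePi_map_curry_symm (fun j i => μ i j)]
  have e2 : (fun (h : κ × ι → X) (p : ι × κ) => h (p.2, p.1)) =
      MeasurableEquiv.piCongrLeft (fun _ => X) (Equiv.prodComm κ ι) := by
    ext h p
    exact (MeasurableEquiv.piCongrLeft_apply_apply (Equiv.prodComm κ ι) (β := fun _ => X) h
      (p.2, p.1)).symm
  rw [e2, ← Measure.infinitePi_map_piCongrLeft (fun p : ι × κ => μ p.1 p.2) (Equiv.prodComm κ ι)]
  rfl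

theorem pi_withDensity_ofReal {ι : Type*} [Fintype ι] (f : ι → ℝ → ℝ) (h0 : ∀ i x, 0 ≤ f i x)
    (hf : ∀ i, Integrable (f i)) [∀ i, SigmaFinite
      ((volume : Measure ℝ).withDensity fun x => ENNReal.ofReal (f i x))] :
    (Measure.pi fun i => (volume : Measure ℝ).withDensity fun x => ENNReal.ofReal (f i x)) =
      (volume : Measure (ι → ℝ)).withDensity fun x => ENNReal.ofReal (∏ i, f i (x i)) := by
  refine Measure.pi_eq fun s hs => ?_
  rw [withDensity_apply _ (.univ_pi hs), ← ofReal_integral_eq_lintegral_ofReal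
    (volume_pi (α := fun _ : ι => ℝ) ▸ Integrable.fintype_prod hf).integrableOn
    (Filter.Eventually.of_forall fun x => Finset.prod_nonneg fun i _ => h0 i _)]
  have : ∀ i, (volume : Measure ℝ).withDensity (fun x => ENNReal.ofReal (f i x)) (s i) =
      ENNReal.ofReal (∫ x, (s i).indicator (f i) x) := fun i => by
    rw [withDensity_apply _ (hs i), ← ofReal_integral_eq_lintegral_ofReal (hf i).integrableOn
      (Filter.Eventually.of_forall fun x => h0 i x), integral_indicator (hs i)]
  simp_rw [this]
  rw [← ENNReal.ofReal_prod_of_nonneg fun i _ => integral_nonneg fun x =>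
      Set.indicator_nonneg (fun x _ => h0 i x) x,
    ← integral_fintype_prod_volume_eq_prod, ← integral_indicator (.univ_pi hs)]
  congr 2 with x
  by_cases hx : x ∈ Set.univ.pi s
  · rw [Set.indicator_of_mem hx]
    exact Finset.prod_congr rfl fun i _ => (Set.indicator_of_mem (hx i (Set.mem_univ i)) _).symm
  · rw [Set.indicator_of_notMem hx]
    simp only [Set.mem_univ_pi, not_forall] at hx
    obtain ⟨i, hi⟩ := hx
    exact (Finset.prod_eq_zero (Finset.mem_univ i) (Set.indicator_of_notMem hi _)).symm

/-- The law of a Gaussian vector with independent entries of variance `σ²`. -/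
noncomputable def gaussianVec {ι : Type*} [Fintype ι] (a : ι → ℝ) (σ : ℝ) : Measure (ι → ℝ) :=
  Measure.pi fun i => gaussianReal (a i) (Real.toNNReal (σ ^ 2))

instance {ι : Type*} [Fintype ι] (a : ι → ℝ) (σ : ℝ) : IsProbabilityMeasure (gaussianVec a σ) := by
  unfold gaussianVec; infer_instance

/-- The ratio of the densities at `x'` and `x` of a Gaussian vector centred at `a`. -/
noncomputable def densityRatio {ι : Type*} [Fintype ι] (a : ι → ℝ) (σ : ℝ) (x x' : ι → ℝ) : ℝ :=
  Real.exp (((x - a) ⬝ᵥ (x - a) - (x' - a) ⬝ᵥ (x' - a)) / (2 * σ ^ 2))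

theorem gaussianVec_eq_withDensity {ι : Type*} [Fintype ι] (a : ι → ℝ) {σ : ℝ} (hσ : 0 < σ) :
    ∃ K : ℝ, 0 ≤ K ∧ gaussianVec a σ = (volume : Measure (ι → ℝ)).withDensity fun x =>
      ENNReal.ofReal (K * Real.exp (-((x - a) ⬝ᵥ (x - a) / (2 * σ ^ 2)))) := by
  have hv : Real.toNNReal (σ ^ 2) ≠ 0 := by simpa using hσ.ne'
  have hs : ∀ i, SigmaFinite ((volume : Measure ℝ).withDensity fun x =>
      ENNReal.ofReal (gaussianPDFReal (a i) (Real.toNNReal (σ ^ 2)) x)) := fun i => by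
    have := gaussianReal_of_var_ne_zero (a i) hv
    rw [gaussianPDF_def] at this
    rw [← this]
    infer_instance
  refine ⟨∏ i : ι, (√(2 * Real.pi * σ ^ 2))⁻¹, by positivity, ?_⟩
  unfold gaussianVec
  simp_rw [gaussianReal_of_var_ne_zero _ hv, gaussianPDF_def]
  rw [pi_withDensity_ofReal _ (fun i => gaussianPDFReal_nonneg _ _)
    (fun i => integrable_gaussianPDFReal _ _)]
  congr 1 with x
  congr 1
  simp only [gaussianPDFReal, Finset.prod_mul_distrib, ← Real.exp_sum,
    Real.coe_toNNReal _ (sq_nonneg σ)]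
  congr 2
  simp only [dotProduct, Finset.sum_div, ← Finset.sum_neg_distrib, Pi.sub_apply]
  exact Finset.sum_congr rfl fun i _ => by ring

theorem gaussianVec_absolutelyContinuous {ι : Type*} [Fintype ι] (a : ι → ℝ) {σ : ℝ}
    (hσ : 0 < σ) : gaussianVec a σ ≪ volume := by
  obtain ⟨K, -, h⟩ := gaussianVec_eq_withDensity a hσ
  rw [h]
  exact withDensity_absolutelyContinuous _ _

/-- The Lebesgue change of variables x ↦ M x, with the density at M x rewritten as the density at x
times `densityRatio`. The result is again an integral against the same Gaussian law. -/
theorem lintegral_gaussianVec_substitution {ι : Type*} [Fintype ι] [DecidableEq ι] (a : ι → ℝ)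
    {σ : ℝ} (hσ : 0 < σ) (M : Matrix ι ι ℝ) (hM : 0 < M.det) {F : (ι → ℝ) → ℝ≥0∞}
    (hF : Measurable F) :
    ∫⁻ x, F x ∂gaussianVec a σ = ENNReal.ofReal M.det *
      ∫⁻ x, F (M *ᵥ x) * ENNReal.ofReal (densityRatio a σ x (M *ᵥ x)) ∂gaussianVec a σ := by
  obtain ⟨K, hK, h⟩ := gaussianVec_eq_withDensity a hσ
  have hMm : Measurable fun x : ι → ℝ => M *ᵥ x :=
    (Continuous.matrix_mulVec continuous_const continuous_id).measurable
  have hv := Real.map_matrix_volume_pi_eq_smul_volume_pi hM.ne'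
  have hvol : (volume : Measure (ι → ℝ)) =
      ENNReal.ofReal M.det • Measure.map (Matrix.toLin' M) volume := by
    rw [hv, smul_smul, ← ENNReal.ofReal_mul hM.le, abs_of_pos (inv_pos.2 hM),
      mul_inv_cancel₀ hM.ne', ENNReal.ofReal_one, one_smul]
  have hd : Measurable fun x : ι → ℝ => ENNReal.ofReal
      (K * Real.exp (-((x - a) ⬝ᵥ (x - a) / (2 * σ ^ 2)))) := by
    unfold dotProduct; fun_prop
  have hr : Measurable fun x : ι → ℝ => ENNReal.ofReal (densityRatio a σ x (M *ᵥ x)) := by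
    have h3 : ∀ i, Measurable fun x : ι → ℝ => (M *ᵥ x) i := measurable_pi_iff.1 hMm
    unfold densityRatio dotProduct
    simp only [Pi.sub_apply]
    fun_prop
  rw [h, lintegral_withDensity_eq_lintegral_mul _ hd hF,
    lintegral_withDensity_eq_lintegral_mul _ hd
      (g := fun x => F (M *ᵥ x) * ENNReal.ofReal (densityRatio a σ x (M *ᵥ x)))
      ((hF.comp hMm).mul hr)]
  conv_lhs => rw [hvol]
  rw [lintegral_smul_measure, smul_eq_mul, lintegral_map (hd.mul hF)
    (show Measurable (Matrix.toLin' M) from hMm)]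
  congr 1
  refine lintegral_congr fun x => ?_
  simp only [Pi.mul_apply, Matrix.toLin'_apply, densityRatio]
  rw [mul_comm (F _), ← mul_assoc, ← ENNReal.ofReal_mul (by positivity), mul_assoc K,
    ← Real.exp_add]
  congr 4
  ring

end SmoothedLP

/-! ### Almost sure nondegeneracy. -/

namespace SmoothedLP

theorem volume_dotProduct_eq_zero {ι : Type*} [Fintype ι] {w : ι → ℝ} (hw : w ≠ 0) :
    (volume : Measure (ι → ℝ)) {b | w ⬝ᵥ b = 0} = 0 := by
  have h := Measure.addHaar_submodule (volume : Measure (ι → ℝ))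
    (LinearMap.ker (dotProductBilin ℝ ℝ w)) (by
      intro h
      have : w ∈ LinearMap.ker (dotProductBilin ℝ ℝ w) := h ▸ Submodule.mem_top
      exact hw (dotProduct_self_eq_zero.1 (by simpa using this)))
  convert h using 2
  ext b
  simp

/-- If `M` is independent of the absolutely continuous vector `b`, almost surely no rows of a
column-restriction of `M` that are linearly dependent can be solved for the entries of `b`. -/
theorem ae_leftKernel_eq_zero {Ω ι κ : Type*} [Fintype ι] [Fintype κ]
    [TopologicalSpace Ω] [MeasurableSpace Ω] [OpensMeasurableSpace Ω] (M : Ω → Matrix ι κ ℝ)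
    (hM : Continuous M) (α : Measure Ω) [SFinite α] (β : Measure (ι → ℝ)) [SFinite β]
    (hβ : β ≪ volume) :
    ∀ᵐ z ∂α.prod β, ∀ (T : Finset ι) (U : Finset κ) (x : κ → ℝ) (w : ι → ℝ),
      (∀ i ∉ U, x i = 0) → (∀ j ∉ T, w j = 0) → (∀ j ∈ T, (M z.1 *ᵥ x) j = z.2 j) →
      (∀ i ∈ U, (w ᵥ* M z.1) i = 0) → w = 0 := by
  let G (T : Finset ι) (U : Finset κ) (z : Ω × (ι → ℝ)) (v : (κ → ℝ) × (ι → ℝ)) : Prop :=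
    (∀ i, i ∉ U → v.1 i = 0) ∧ (∀ j, j ∉ T → v.2 j = 0) ∧ (∀ j, j ∈ T → (M z.1 *ᵥ v.1) j = z.2 j) ∧
      (∀ i, i ∈ U → (v.2 ᵥ* M z.1) i = 0)
  -- The bad set is a projection along (x, w). The conditions on w are homogeneous, so w may be
  -- taken on the unit sphere, and x is exhausted by balls. The fibres are then compact, so each bad
  -- set is closed and hence measurable.
  let K (R : ℕ) : Set ((κ → ℝ) × (ι → ℝ)) := Metric.closedBall 0 R ×ˢ Metric.sphere 0 1
  have hK : ∀ R, CompactSpace (K R) := fun R =>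
    isCompact_iff_compactSpace.1 ((isCompact_closedBall _ _).prod (isCompact_sphere _ _))
  let N (T : Finset ι) (U : Finset κ) (R : ℕ) : Set (Ω × (ι → ℝ)) := {z | ∃ v ∈ K R, G T U z v}
  have hN : ∀ T U R, IsClosed (N T U R) := fun T U R => by
    have hcl : IsClosed {q : (Ω × (ι → ℝ)) × K R | G T U q.1 q.2} := by
      have hM' : Continuous fun q : (Ω × (ι → ℝ)) × K R => M q.1.1 := by fun_prop
      have h1 : Continuous fun q : (Ω × (ι → ℝ)) × K R => M q.1.1 *ᵥ q.2.1.1 :=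
        hM'.matrix_mulVec (by fun_prop)
      have h2 : Continuous fun q : (Ω × (ι → ℝ)) × K R => q.2.1.2 ᵥ* M q.1.1 :=
        Continuous.matrix_vecMul (by fun_prop) hM'
      simp only [G, Set.ofPred_and, Set.ofPred_forall]
      refine ((isClosed_iInter fun i => isClosed_iInter fun _ => ?_).inter
        ((isClosed_iInter fun i => isClosed_iInter fun _ => ?_).inter
        ((isClosed_iInter fun i => isClosed_iInter fun _ => ?_).inter
        (isClosed_iInter fun i => isClosed_iInter fun _ => ?_))))
      · exact isClosed_eq (by fun_prop) continuous_const
      · exact isClosed_eq (by fun_prop) continuous_const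
      · exact isClosed_eq ((continuous_apply i).comp h1) (by fun_prop)
      · exact isClosed_eq ((continuous_apply i).comp h2) continuous_const
    have := hK R
    convert isClosedMap_fst_of_compactSpace _ hcl using 1
    ext z
    simp only [N, Set.mem_ofPred_eq, Set.mem_image, Prod.exists, Subtype.exists]
    constructor
    · rintro ⟨v1, v2, hv, h⟩
      exact ⟨z.1, z.2, v1, v2, hv, h, rfl⟩
    · rintro ⟨a, b, v1, v2, hv, h, rfl⟩
      exact ⟨v1, v2, hv, h⟩
  have hN0 : ∀ T U R, (α.prod β) (N T U R) = 0 := fun T U R => by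
    rw [Measure.measure_prod_null (hN T U R).measurableSet]
    refine Filter.Eventually.of_forall fun A => ?_
    -- A single w, chosen from A alone, serves for all b: w · b = w · (M x) = 0, so b lies in one
    -- fixed hyperplane.
    by_cases hw : ∃ w ∈ Metric.sphere (0 : ι → ℝ) 1, (∀ j, j ∉ T → w j = 0) ∧
        ∀ i, i ∈ U → (w ᵥ* M A) i = 0
    · obtain ⟨w, hw1, hwT, hwU⟩ := hw
      refine hβ (measure_mono_null ?_ (volume_dotProduct_eq_zero (w := w) ?_))
      · rintro b ⟨v, -, hv1, -, hv3, -⟩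
        have e1 : w ⬝ᵥ b = w ⬝ᵥ (M A *ᵥ v.1) := Finset.sum_congr rfl fun j _ => by
          by_cases hj : j ∈ T
          · rw [hv3 j hj]
          · rw [hwT j hj, zero_mul, zero_mul]
        rw [Set.mem_ofPred_eq, e1, Matrix.dotProduct_mulVec]
        exact Finset.sum_eq_zero fun i _ => by
          by_cases hi : i ∈ U
          · rw [hwU i hi, zero_mul]
          · rw [hv1 i hi, mul_zero]
      · rintro rfl
        simp at hw1
    · have : Prod.mk A ⁻¹' N T U R = ∅ := by
        refine Set.eq_empty_of_forall_notMem ?_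
        rintro b ⟨v, hv, -, hv2, -, hv4⟩
        exact hw ⟨v.2, hv.2, hv2, hv4⟩
      simp [this]
  have hall : ∀ᵐ z ∂α.prod β, ∀ T U R, z ∉ N T U R := by
    simp only [ae_all_iff]
    exact fun T U R => measure_eq_zero_iff_ae_notMem.1 (hN0 T U R)
  filter_upwards [hall] with z hz T U x w hx hw hxT hwU
  by_contra hw0
  obtain ⟨R, hR⟩ := exists_nat_ge ‖x‖
  have hpos : 0 < ‖w‖ := norm_pos_iff.2 hw0
  refine hz T U R ⟨(x, ‖w‖⁻¹ • w), ⟨by simpa using hR, ?_⟩, hx, fun j hj => ?_, hxT, fun i hi => ?_⟩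
  · simp [norm_smul, hpos.ne']
  · simp [hw j hj]
  · simp [Matrix.smul_vecMul, hwU i hi]

/-- Nondegeneracy of the program `(A, b, c)`: a subsystem of `A x ≤ b` that is tight at `x`
has linearly independent rows on the support of `x`, and dually. -/
def Nondegenerate {m n : ℕ} (A : Matrix (Fin m) (Fin n) ℝ) (b : Fin m → ℝ) (c : Fin n → ℝ) :
    Prop :=
  (∀ (T : Finset (Fin m)) (U : Finset (Fin n)) (x : Fin n → ℝ) (w : Fin m → ℝ),
      (∀ i ∉ U, x i = 0) → (∀ j ∉ T, w j = 0) → (∀ j ∈ T, (A *ᵥ x) j = b j) →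
      (∀ i ∈ U, (w ᵥ* A) i = 0) → w = 0) ∧
  (∀ (T : Finset (Fin n)) (U : Finset (Fin m)) (y : Fin m → ℝ) (w : Fin n → ℝ),
      (∀ j ∉ U, y j = 0) → (∀ i ∉ T, w i = 0) → (∀ i ∈ T, (y ᵥ* A) i = c i) →
      (∀ j ∈ U, (A *ᵥ w) j = 0) → w = 0)

theorem ae_nondegenerate {m n : ℕ} (A₀ : Matrix (Fin m) (Fin n) ℝ) (b₀ : Fin m → ℝ)
    (c₀ : Fin n → ℝ) {σ : ℝ} (hσ : 0 < σ) :
    ∀ᵐ p ∂gaussianLP A₀ b₀ c₀ σ, Nondegenerate (Matrix.of p.1) p.2.1 p.2.2 := by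
  let α : Measure (Fin m → Fin n → ℝ) :=
    Measure.pi fun i => Measure.pi fun j => gaussianReal (A₀ i j) (Real.toNNReal (σ ^ 2))
  have : IsProbabilityMeasure α := by
    have : ∀ i, IsProbabilityMeasure
        (Measure.pi fun j => gaussianReal (A₀ i j) (Real.toNNReal (σ ^ 2))) := fun i => inferInstance
    infer_instance
  have hof : Continuous fun A : Fin m → Fin n → ℝ => Matrix.of A :=
    continuous_matrix fun i j => by simp only [Matrix.of_apply]; fun_prop
  have hL : gaussianLP A₀ b₀ c₀ σ = α.prod ((gaussianVec b₀ σ).prod (gaussianVec c₀ σ)) := rfl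
  have h1 : MeasurePreserving (fun p : (Fin m → Fin n → ℝ) × (Fin m → ℝ) × (Fin n → ℝ) =>
      (p.1, p.2.1)) (α.prod ((gaussianVec b₀ σ).prod (gaussianVec c₀ σ)))
      (α.prod (gaussianVec b₀ σ)) :=
    (MeasurePreserving.id α).prod measurePreserving_fst
  have h2 : MeasurePreserving (fun p : (Fin m → Fin n → ℝ) × (Fin m → ℝ) × (Fin n → ℝ) =>
      (p.1, p.2.2)) (α.prod ((gaussianVec b₀ σ).prod (gaussianVec c₀ σ)))
      (α.prod (gaussianVec c₀ σ)) :=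
    (MeasurePreserving.id α).prod measurePreserving_snd
  rw [hL]
  filter_upwards [h1.quasiMeasurePreserving.ae (ae_leftKernel_eq_zero
      (fun A : Fin m → Fin n → ℝ => Matrix.of A) hof α (gaussianVec b₀ σ)
      (gaussianVec_absolutelyContinuous b₀ hσ)),
    h2.quasiMeasurePreserving.ae (ae_leftKernel_eq_zero
      (fun A : Fin m → Fin n → ℝ => (Matrix.of A)ᵀ) hof.matrix_transpose
      α (gaussianVec c₀ σ) (gaussianVec_absolutelyContinuous c₀ hσ))] with p hp1 hp2
  refine ⟨hp1, fun T U y w h1 h2 h3 h4 => hp2 T U y w h1 h2 ?_ ?_⟩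
  · simpa [Matrix.mulVec_transpose] using h3
  · simpa [Matrix.vecMul_transpose] using h4

end SmoothedLP

/-! ### Scaling one column along the normal of the others. -/

namespace SmoothedLP

section LinearAlgebra

variable {κ : Type*} [Fintype κ]

theorem abs_dotProduct_le (u v : κ → ℝ) : |u ⬝ᵥ v| ≤ √(u ⬝ᵥ u) * √(v ⬝ᵥ v) := by
  rw [← Real.sqrt_mul (by simpa using dotProduct_star_self_nonneg u), ← Real.sqrt_sq_eq_abs]
  refine Real.sqrt_le_sqrt ?_
  have := Finset.sum_mul_sq_le_sq_mul_sq Finset.univ u v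
  simpa only [dotProduct, ← sq] using this

theorem dotProduct_self_nonneg' (u : κ → ℝ) : 0 ≤ u ⬝ᵥ u :=
  Finset.sum_nonneg fun i _ => mul_self_nonneg (u i)

/-- The linear map that scales the component along the unit vector `q` by `l`. -/
def scaleAlong (q : κ → ℝ) (l : ℝ) (v : κ → ℝ) : κ → ℝ := v - ((1 - l) * (q ⬝ᵥ v)) • q

theorem dotProduct_scaleAlong {q : κ → ℝ} (hq : q ⬝ᵥ q = 1) (l : ℝ) (v : κ → ℝ) :
    q ⬝ᵥ scaleAlong q l v = l * (q ⬝ᵥ v) := by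
  rw [scaleAlong, dotProduct_sub, dotProduct_smul, hq, smul_eq_mul]
  ring

theorem scaleAlong_injective {q : κ → ℝ} (hq : q ⬝ᵥ q = 1) {l : ℝ} (hl : l ≠ 0) {u v : κ → ℝ}
    (h : scaleAlong q l u = scaleAlong q l v) : u = v := by
  have h1 := congrArg (q ⬝ᵥ ·) h
  simp only [dotProduct_scaleAlong hq] at h1
  have h2 := mul_left_cancel₀ hl h1
  unfold scaleAlong at h
  rw [h2] at h
  exact sub_left_injective h

theorem scaleAlong_density {q : κ → ℝ} (hq : q ⬝ᵥ q = 1) (l : ℝ) (v a : κ → ℝ) :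
    (v - a) ⬝ᵥ (v - a) - (scaleAlong q l v - a) ⬝ᵥ (scaleAlong q l v - a) =
      (1 - l ^ 2) * (q ⬝ᵥ v) ^ 2 - 2 * (1 - l) * (q ⬝ᵥ v) * (q ⬝ᵥ a) := by
  simp only [scaleAlong, sub_dotProduct, dotProduct_sub, smul_dotProduct, dotProduct_smul,
    smul_eq_mul, hq, dotProduct_comm v q, dotProduct_comm a q, dotProduct_comm a v]
  ring

variable [DecidableEq κ]

/-- The identity minus the rank one matrix `u wᵀ`. -/
def rankOneUpdate (u w : κ → ℝ) : Matrix κ κ ℝ := 1 - Matrix.vecMulVec u w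

theorem rankOneUpdate_mulVec (u w v : κ → ℝ) : rankOneUpdate u w *ᵥ v = v - (w ⬝ᵥ v) • u := by
  rw [rankOneUpdate, Matrix.sub_mulVec, Matrix.one_mulVec, Matrix.vecMulVec_mulVec]
  ext i
  simp [mul_comm]

theorem det_rankOneUpdate (u w : κ → ℝ) : (rankOneUpdate u w).det = 1 - w ⬝ᵥ u := by
  have h := Matrix.det_one_add_replicateCol_mul_replicateRow (ι := Unit) (-u) w
  rw [dotProduct_neg, ← sub_eq_add_neg] at h
  rw [← h, rankOneUpdate]
  congr 1
  ext i j
  simp [Matrix.vecMulVec_apply, Matrix.mul_apply, sub_eq_add_neg]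

/-- The vector of cofactors of the `k`-th column, normalized: it is orthogonal to the other
columns. -/
noncomputable def normal (B : Matrix κ κ ℝ) (k : κ) : κ → ℝ :=
  (√(B.adjugate k ⬝ᵥ B.adjugate k))⁻¹ • B.adjugate k

/-- The signed distance of the `k`-th column from the span of the other columns. -/
noncomputable def height (B : Matrix κ κ ℝ) (k : κ) : ℝ := normal B k ⬝ᵥ B.col k

/-- The projection of the `k`-th column to the span of the other columns. -/
noncomputable def residual (B : Matrix κ κ ℝ) (k : κ) : κ → ℝ :=
  B.col k - height B k • normal B k

/-- These cofactors do not involve column k. The normal is therefore constant while that column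
varies, which makes the scaling linear in the column. -/
theorem adjugate_updateCol_self (B : Matrix κ κ ℝ) (k : κ) (v : κ → ℝ) :
    (B.updateCol k v).adjugate k = B.adjugate k := by
  have h : ∀ (A : Matrix κ κ ℝ) j, A.adjugate k j = (Aᵀ.updateRow k (Pi.single j 1)).det :=
    fun A j => by rw [← Matrix.adjugate_apply, ← Matrix.adjugate_transpose, Matrix.transpose_apply]
  ext j
  rw [h, h, ← Matrix.updateRow_transpose, Matrix.updateRow_idem]

theorem normal_updateCol (B : Matrix κ κ ℝ) (k : κ) (v : κ → ℝ) :
    normal (B.updateCol k v) k = normal B k := by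
  rw [normal, adjugate_updateCol_self, normal]

theorem adjugate_vecMul (B : Matrix κ κ ℝ) (k : κ) :
    B.adjugate k ᵥ* B = B.det • Pi.single k 1 := by
  have := B.adjugate_mul
  ext j
  have h := congrFun (congrFun this k) j
  rw [Matrix.mul_apply] at h
  simpa [Matrix.vecMul, dotProduct, Matrix.one_apply, Pi.single_apply, eq_comm] using h

theorem normal_dotProduct_self {B : Matrix κ κ ℝ} {k : κ} (h : B.adjugate k ≠ 0) :
    normal B k ⬝ᵥ normal B k = 1 := by
  have h0 : 0 < B.adjugate k ⬝ᵥ B.adjugate k :=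
    lt_of_le_of_ne (dotProduct_self_nonneg' _) fun e => h (dotProduct_self_eq_zero.1 e.symm)
  have := Real.mul_self_sqrt h0.le
  have h1 := Real.sqrt_pos.2 h0
  rw [normal, smul_dotProduct, dotProduct_smul, smul_eq_mul, smul_eq_mul]
  field_simp
  rw [sq, this]

theorem adjugate_ne_zero {B : Matrix κ κ ℝ} (h : B.det ≠ 0) (k : κ) : B.adjugate k ≠ 0 := by
  intro h0
  have := congrFun (adjugate_vecMul B k) k
  simp [h0] at this
  exact h this.symm

theorem normal_vecMul (B : Matrix κ κ ℝ) (k : κ) :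
    normal B k ᵥ* B = height B k • Pi.single k 1 := by
  have h : normal B k ᵥ* B =
      ((√(B.adjugate k ⬝ᵥ B.adjugate k))⁻¹ * B.det) • (Pi.single k 1 : κ → ℝ) := by
    rw [normal, Matrix.smul_vecMul, adjugate_vecMul, smul_smul]
  have h2 : height B k = (√(B.adjugate k ⬝ᵥ B.adjugate k))⁻¹ * B.det := by
    have := congrFun h k
    simp only [Pi.smul_apply, Pi.single_eq_same, smul_eq_mul, mul_one] at this
    exact this
  rw [h, h2]

theorem det_eq_zero_iff_height {B : Matrix κ κ ℝ} {k : κ} (h : B.adjugate k ≠ 0) :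
    B.det = 0 ↔ height B k = 0 := by
  have h0 : 0 < B.adjugate k ⬝ᵥ B.adjugate k :=
    lt_of_le_of_ne (dotProduct_self_nonneg' _) fun e => h (dotProduct_self_eq_zero.1 e.symm)
  have h1 := Real.sqrt_pos.2 h0
  have h2 : height B k = (√(B.adjugate k ⬝ᵥ B.adjugate k))⁻¹ * B.det := by
    have h3 := congrFun (adjugate_vecMul B k) k
    simp only [Matrix.vecMul, Pi.smul_apply, Pi.single_eq_same, smul_eq_mul, mul_one] at h3
    rw [height, normal, smul_dotProduct, smul_eq_mul, ← h3]
    rfl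
  rw [h2, mul_eq_zero]
  simp [h1.ne']

theorem updateCol_mulVec (B : Matrix κ κ ℝ) (k : κ) (v x : κ → ℝ) :
    B.updateCol k v *ᵥ x = B *ᵥ x + x k • (v - B.col k) := by
  have : B.updateCol k v = B + Matrix.vecMulVec (v - B.col k) (Pi.single k 1) := by
    ext i j
    rcases eq_or_ne j k with rfl | h
    · simp [Matrix.vecMulVec_apply]
    · simp [Matrix.vecMulVec_apply, h]
  rw [this, Matrix.add_mulVec, Matrix.vecMulVec_mulVec]
  ext i
  simp [mul_comm]

theorem vecMul_updateCol (B : Matrix κ κ ℝ) (k : κ) (v y : κ → ℝ) :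
    y ᵥ* B.updateCol k v = y ᵥ* B + (y ⬝ᵥ (v - B.col k)) • Pi.single k 1 := by
  have : B.updateCol k v = B + Matrix.vecMulVec (v - B.col k) (Pi.single k 1) := by
    ext i j
    rcases eq_or_ne j k with rfl | h
    · simp [Matrix.vecMulVec_apply]
    · simp [Matrix.vecMulVec_apply, h]
  rw [this, Matrix.vecMul_add, Matrix.vecMul_vecMulVec]

/-- Undoing the scaling of the `k`-th column along the normal of the other columns. -/
theorem solution_of_scaled_solution {B : Matrix κ κ ℝ} {k : κ} (hB : B.det ≠ 0) {l : ℝ}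
    (hl : l ≠ 0) {x y b c : κ → ℝ}
    (hx : B.updateCol k (scaleAlong (normal B k) l (B.col k)) *ᵥ x =
      scaleAlong (normal B k) l b)
    (hy : y ᵥ* B.updateCol k (scaleAlong (normal B k) l (B.col k)) =
      c - ((1 - l) * height B k * ((B⁻¹ *ᵥ normal B k) ⬝ᵥ c)) • Pi.single k 1) :
    B *ᵥ x = b ∧ y ᵥ* B = c := by
  have hq := normal_dotProduct_self (adjugate_ne_zero hB k)
  have hqB := normal_vecMul B k
  have ht : normal B k ⬝ᵥ B.col k = height B k := rfl
  have hz : B *ᵥ (B⁻¹ *ᵥ normal B k) = normal B k := by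
    rw [Matrix.mulVec_mulVec, Matrix.mul_nonsing_inv _ (isUnit_iff_ne_zero.2 hB),
      Matrix.one_mulVec]
  generalize normal B k = q at *
  generalize height B k = t at *
  generalize hzz : B⁻¹ *ᵥ q = z at *
  have hd : scaleAlong q l (B.col k) - B.col k = -((1 - l) * t) • q := by
    rw [scaleAlong, ht, neg_smul]; abel
  have hqx : ∀ v, q ⬝ᵥ (B *ᵥ v) = t * v k := fun v => by
    rw [Matrix.dotProduct_mulVec, hqB, smul_dotProduct, single_dotProduct, one_mul, smul_eq_mul]
  constructor
  · refine scaleAlong_injective hq hl ?_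
    rw [← hx, updateCol_mulVec, hd, scaleAlong, hqx, smul_smul, sub_eq_add_neg, ← neg_smul]
    congr 2
    ring
  · rw [vecMul_updateCol, hd, dotProduct_smul, smul_eq_mul] at hy
    have hyq : y ⬝ᵥ q = (y ᵥ* B) ⬝ᵥ z := by rw [← Matrix.dotProduct_mulVec, hz]
    have hzk : t * z k = 1 := by rw [← hqx, hz, hq]
    -- The defect d is a multiple of the k-th unit vector whose coefficient involves d · z itself.
    -- Pairing with z, where t z_k = 1, gives d · z = (1 - l)(d · z), so d · z = 0 and d = 0.
    set d := y ᵥ* B - c with hdd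
    have e : d = ((1 - l) * t * (d ⬝ᵥ z)) • Pi.single k 1 := by
      have hdz : d ⬝ᵥ z = y ⬝ᵥ q - z ⬝ᵥ c := by
        rw [hdd, sub_dotProduct, hyq, dotProduct_comm c]
      ext i
      have := congrFun hy i
      simp only [Pi.add_apply, Pi.sub_apply, Pi.smul_apply, smul_eq_mul] at this
      rw [hdz, hdd]
      simp only [Pi.sub_apply, Pi.smul_apply, smul_eq_mul]
      linear_combination this
    have e2 : d ⬝ᵥ z = (1 - l) * (d ⬝ᵥ z) := by
      conv_lhs => rw [e]
      rw [smul_dotProduct, single_dotProduct, one_mul, smul_eq_mul]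
      linear_combination (1 - l) * (d ⬝ᵥ z) * hzk
    have e3 : d ⬝ᵥ z = 0 := by
      have : l * (d ⬝ᵥ z) = 0 := by linarith
      exact (mul_eq_zero.1 this).resolve_left hl
    rw [e3, mul_zero, zero_smul] at e
    exact sub_eq_zero.1 e

end LinearAlgebra

/-- The density ratio of the scaling map is at most `e` close to the degenerate locus. -/
theorem exponent_le_one {σ t l X xk η Y α β δ W : ℝ} (hσ : 0 < σ) (hσ1 : σ ^ 2 ≤ 1)
    (hl0 : 0 ≤ l) (hl1 : l ≤ 1) (hY : 0 ≤ Y) (hW : 0 ≤ W)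
    (hxk : |xk| ≤ X) (hη : |η| ≤ Y) (hα : |α| ≤ 1) (hβ : |β| ≤ 1) (hδ : |δ| ≤ 1 + Y * W)
    (ht : |t| * ((1 + X ^ 2 + Y ^ 2) * (W + 3)) ≤ σ ^ 2) :
    (((1 - l ^ 2) * t ^ 2 - 2 * (1 - l) * t * α) +
      ((1 - l ^ 2) * (xk * t) ^ 2 - 2 * (1 - l) * (xk * t) * β) +
      ((1 - l ^ 2) * (η * t) ^ 2 - 2 * (1 - l) * (η * t) * δ)) / (2 * σ ^ 2) ≤ 1 := by
  have hσ2 : 0 < σ ^ 2 := by positivity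
  rw [div_le_one (by positivity)]
  have hX : 0 ≤ X := (abs_nonneg _).trans hxk
  set S := 1 + X ^ 2 + Y ^ 2 with hS
  have hS1 : 1 ≤ S := by rw [hS]; nlinarith
  have ht3 : |t| ≤ 1 := by
    have : |t| * 1 ≤ |t| * (S * (W + 3)) :=
      mul_le_mul_of_nonneg_left (by nlinarith) (abs_nonneg t)
    linarith
  -- The linear part costs (W + 2) S and enters twice; the quadratic part costs S, using t² ≤ |t|.
  -- The total is |t| (2 W + 5) S ≤ 2 |t| (W + 3) S, whence the constant 3.
  have hb : |α + xk * β + η * δ| ≤ (W + 2) * S := by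
    have h1 : |xk * β| ≤ X := by
      rw [abs_mul]
      calc |xk| * |β| ≤ X * 1 := mul_le_mul hxk hβ (abs_nonneg _) hX
        _ = X := mul_one X
    have h2 : |η * δ| ≤ Y * (1 + Y * W) := by
      rw [abs_mul]
      exact mul_le_mul hη hδ (abs_nonneg _) hY
    have h3 := abs_add_three α (xk * β) (η * δ)
    have h4 : 1 + X + Y * (1 + Y * W) ≤ (W + 2) * S := by
      rw [hS]
      nlinarith [sq_nonneg (X - 1), sq_nonneg (Y - 1), mul_nonneg hW (sq_nonneg X)]
    linarith
  have ha : 1 + xk ^ 2 + η ^ 2 ≤ S := by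
    rw [hS]
    have := sq_le_sq' (abs_le.1 hxk).1 (abs_le.1 hxk).2
    have := sq_le_sq' (abs_le.1 hη).1 (abs_le.1 hη).2
    linarith
  have h1 : -(t * (α + xk * β + η * δ)) ≤ |t| * ((W + 2) * S) := by
    refine (neg_le_abs _).trans ?_
    rw [abs_mul]
    exact mul_le_mul_of_nonneg_left hb (abs_nonneg t)
  have h2 : t ^ 2 * (1 + xk ^ 2 + η ^ 2) ≤ |t| * S := by
    rw [← sq_abs t]
    have : |t| ^ 2 ≤ |t| := by nlinarith [abs_nonneg t]
    exact mul_le_mul this ha (by positivity) (abs_nonneg t)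
  have h3 : (1 - l ^ 2) * (t ^ 2 * (1 + xk ^ 2 + η ^ 2)) ≤ |t| * S := by
    have : 0 ≤ t ^ 2 * (1 + xk ^ 2 + η ^ 2) := by positivity
    nlinarith [mul_nonneg (sq_nonneg l) this]
  have h5 : (1 - l) * (-(t * (α + xk * β + η * δ))) ≤ |t| * ((W + 2) * S) := by
    have h0 : 0 ≤ |t| * ((W + 2) * S) := by positivity
    have := mul_le_mul_of_nonneg_left h1 (sub_nonneg.2 hl1)
    have := mul_nonneg hl0 h0
    linarith
  have h6 : 0 ≤ |t| * S := by positivity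
  nlinarith

end SmoothedLP

/-! ### Basic solutions and measurability of their events. -/

namespace SmoothedLP

theorem measurable_dotProduct {Ω κ : Type*} [MeasurableSpace Ω] [Fintype κ] {u v : Ω → κ → ℝ}
    (hu : ∀ i, Measurable fun p => u p i) (hv : ∀ i, Measurable fun p => v p i) :
    Measurable fun p => u p ⬝ᵥ v p := by
  unfold dotProduct
  exact Finset.measurable_sum _ fun i _ => (hu i).mul (hv i)

/-- The square submatrix with rows `f` and columns `g` of the matrix with columns `C`. -/
def block {κ : Type*} {m n : ℕ} (C : Fin n → Fin m → ℝ) (f : κ → Fin m) (g : κ → Fin n) : Matrix κ κ ℝ :=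
  Matrix.of fun s r => C (g r) (f s)

theorem measurable_block {κ : Type*} {m n : ℕ} (f : κ → Fin m) (g : κ → Fin n) (s r : κ) :
    Measurable fun p : (Fin n → Fin m → ℝ) × (Fin m → ℝ) × (Fin n → ℝ) => block p.1 f g s r := by
  simp only [block, Matrix.of_apply]
  fun_prop

variable {κ : Type*} [Fintype κ] [DecidableEq κ] {m n : ℕ}

/-- `x` and `y` are the positive entries of the basic primal and dual solutions of the program
with matrix columns `C`, for the basis with rows `f` and columns `g`, and these solutions are
feasible. -/
structure IsBasicSolution (f : κ → Fin m) (g : κ → Fin n) (C : Fin n → Fin m → ℝ) (b : Fin m → ℝ)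
    (c : Fin n → ℝ) (x y : κ → ℝ) : Prop where
  det_ne_zero : (block C f g).det ≠ 0
  mulVec_eq : block C f g *ᵥ x = b ∘ f
  vecMul_eq : y ᵥ* block C f g = c ∘ g
  primal_pos : ∀ r, 0 < x r
  dual_pos : ∀ s, 0 < y s
  primal_le : ∀ j, j ∉ Set.range f → ∑ r, C (g r) j * x r ≤ b j
  dual_le : ∀ i, i ∉ Set.range g → c i ≤ ∑ s, y s * C i (f s)

/-- The event that the basis with rows `f` and columns `g` is optimal. -/
def optimalBasis (f : κ → Fin m) (g : κ → Fin n) :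
    Set ((Fin n → Fin m → ℝ) × (Fin m → ℝ) × (Fin n → ℝ)) :=
  {p | ∃ x y, IsBasicSolution f g p.1 p.2.1 p.2.2 x y}

/-- The quantity that is small when the `k`-th column is close to the span of the others. -/
noncomputable def scaledHeight (B : Matrix κ κ ℝ) (k : κ) (x y : κ → ℝ) : ℝ :=
  |height B k| * ((1 + x ⬝ᵥ x + y ⬝ᵥ y) * (√(residual B k ⬝ᵥ residual B k) + 3))

/-- The event that the basis with rows `f` and columns `g` is optimal and its `k`-th column is
close to the span of the others. -/
def smallHeight (f : κ → Fin m) (g : κ → Fin n) (k : κ) (ε : ℝ) :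
    Set ((Fin n → Fin m → ℝ) × (Fin m → ℝ) × (Fin n → ℝ)) :=
  {p | ∃ x y, IsBasicSolution f g p.1 p.2.1 p.2.2 x y ∧
    scaledHeight (block p.1 f g) k x y ≤ ε}

theorem smallHeight_subset (f : κ → Fin m) (g : κ → Fin n) (k : κ) (ε : ℝ) :
    smallHeight f g k ε ⊆ optimalBasis f g := fun _ ⟨x, y, h, _⟩ => ⟨x, y, h⟩

section Measurability

variable {Ω : Type*} [MeasurableSpace Ω]

theorem measurable_det {B : Ω → Matrix κ κ ℝ} (hB : ∀ i j, Measurable fun p => B p i j) :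
    Measurable fun p => (B p).det := by
  simp only [Matrix.det_apply']
  exact Finset.measurable_sum _ fun s _ => (Finset.measurable_prod _ fun i _ => hB _ _).const_mul _

theorem measurable_adjugate {B : Ω → Matrix κ κ ℝ} (hB : ∀ i j, Measurable fun p => B p i j)
    (i j : κ) : Measurable fun p => (B p).adjugate i j := by
  simp only [Matrix.adjugate_apply]
  refine measurable_det fun a b => ?_
  by_cases h : a = j
  · simp [h]
  · simpa [h] using hB a b

theorem measurable_inv {B : Ω → Matrix κ κ ℝ} (hB : ∀ i j, Measurable fun p => B p i j)
    (i j : κ) : Measurable fun p => (B p)⁻¹ i j := by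
  simp only [Matrix.inv_def, Ring.inverse_eq_inv', Matrix.smul_apply, smul_eq_mul]
  exact (measurable_det hB).inv.mul (measurable_adjugate hB i j)

theorem measurable_normal {B : Ω → Matrix κ κ ℝ} (hB : ∀ i j, Measurable fun p => B p i j)
    (k i : κ) : Measurable fun p => normal (B p) k i := by
  simp only [normal, Pi.smul_apply, smul_eq_mul]
  exact (measurable_dotProduct (measurable_adjugate hB k) (measurable_adjugate hB k)).sqrt.inv.mul
    (measurable_adjugate hB k i)

theorem measurable_height {B : Ω → Matrix κ κ ℝ} (hB : ∀ i j, Measurable fun p => B p i j)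
    (k : κ) : Measurable fun p => height (B p) k :=
  measurable_dotProduct (measurable_normal hB k) fun i => hB i k

theorem measurable_scaledHeight {B : Ω → Matrix κ κ ℝ} {x y : Ω → κ → ℝ}
    (hB : ∀ i j, Measurable fun p => B p i j) (hx : ∀ i, Measurable fun p => x p i)
    (hy : ∀ i, Measurable fun p => y p i) (k : κ) :
    Measurable fun p => scaledHeight (B p) k (x p) (y p) := by
  have hr : ∀ i, Measurable fun p => residual (B p) k i := fun i => by
    simp only [residual, Pi.sub_apply, Pi.smul_apply, smul_eq_mul]
    exact (hB i k).sub ((measurable_height hB k).mul (measurable_normal hB k i))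
  unfold scaledHeight
  refine (continuous_abs.measurable.comp (measurable_height hB k)).mul (Measurable.mul ?_ ?_)
  · exact ((measurable_dotProduct hx hx).const_add 1).add (measurable_dotProduct hy hy)
  · exact (measurable_dotProduct hr hr).sqrt.add_const 3

end Measurability

theorem IsBasicSolution.primal_eq {f : κ → Fin m} {g : κ → Fin n} {C : Fin n → Fin m → ℝ}
    {b : Fin m → ℝ} {c : Fin n → ℝ} {x y : κ → ℝ} (h : IsBasicSolution f g C b c x y) :
    x = (block C f g)⁻¹ *ᵥ (b ∘ f) := by
  rw [← h.mulVec_eq, Matrix.mulVec_mulVec,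
    Matrix.nonsing_inv_mul _ (isUnit_iff_ne_zero.2 h.det_ne_zero), Matrix.one_mulVec]

theorem IsBasicSolution.dual_eq {f : κ → Fin m} {g : κ → Fin n} {C : Fin n → Fin m → ℝ}
    {b : Fin m → ℝ} {c : Fin n → ℝ} {x y : κ → ℝ} (h : IsBasicSolution f g C b c x y) :
    y = (c ∘ g) ᵥ* (block C f g)⁻¹ := by
  rw [← h.vecMul_eq, Matrix.vecMul_vecMul,
    Matrix.mul_nonsing_inv _ (isUnit_iff_ne_zero.2 h.det_ne_zero), Matrix.vecMul_one]

section

variable (f : κ → Fin m) (g : κ → Fin n)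

theorem measurable_primalSolution (r : κ) :
    Measurable fun p : (Fin n → Fin m → ℝ) × (Fin m → ℝ) × (Fin n → ℝ) =>
      ((block p.1 f g)⁻¹ *ᵥ (p.2.1 ∘ f)) r :=
  measurable_dotProduct (fun i => measurable_inv (measurable_block f g) r i)
    fun i => by simp only [Function.comp_apply]; fun_prop

theorem measurable_dualSolution (s : κ) :
    Measurable fun p : (Fin n → Fin m → ℝ) × (Fin m → ℝ) × (Fin n → ℝ) =>
      ((p.2.2 ∘ g) ᵥ* (block p.1 f g)⁻¹) s :=
  measurable_dotProduct (fun i => by simp only [Function.comp_apply]; fun_prop)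
    fun i => measurable_inv (measurable_block f g) i s

/-- A basic solution is determined by the data through the inverse block. Inserting these formulas
removes the existential quantifiers from the events. -/
theorem measurableSet_isBasicSolution :
    MeasurableSet {p : (Fin n → Fin m → ℝ) × (Fin m → ℝ) × (Fin n → ℝ) |
      IsBasicSolution f g p.1 p.2.1 p.2.2 ((block p.1 f g)⁻¹ *ᵥ (p.2.1 ∘ f))
        ((p.2.2 ∘ g) ᵥ* (block p.1 f g)⁻¹)} := by
  have hB := measurable_block (m := m) (n := n) f g
  have hx := measurable_primalSolution f g
  have hy := measurable_dualSolution f g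
  have h1 : MeasurableSet {p : (Fin n → Fin m → ℝ) × (Fin m → ℝ) × (Fin n → ℝ) |
      (block p.1 f g).det = 0} := measurableSet_eq_fun (measurable_det hB) measurable_const
  have h2 : ∀ r, MeasurableSet {p : (Fin n → Fin m → ℝ) × (Fin m → ℝ) × (Fin n → ℝ) |
      0 < ((block p.1 f g)⁻¹ *ᵥ (p.2.1 ∘ f)) r} := fun r =>
    measurableSet_lt measurable_const (hx r)
  have h3 : ∀ s, MeasurableSet {p : (Fin n → Fin m → ℝ) × (Fin m → ℝ) × (Fin n → ℝ) |
      0 < ((p.2.2 ∘ g) ᵥ* (block p.1 f g)⁻¹) s} := fun s =>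
    measurableSet_lt measurable_const (hy s)
  have h4 : ∀ j, MeasurableSet {p : (Fin n → Fin m → ℝ) × (Fin m → ℝ) × (Fin n → ℝ) |
      ∑ r, p.1 (g r) j * ((block p.1 f g)⁻¹ *ᵥ (p.2.1 ∘ f)) r ≤ p.2.1 j} := fun j =>
    measurableSet_le (Finset.measurable_sum _ fun r _ =>
      Measurable.mul (by fun_prop) (hx r)) (by fun_prop)
  have h5 : ∀ i, MeasurableSet {p : (Fin n → Fin m → ℝ) × (Fin m → ℝ) × (Fin n → ℝ) |
      p.2.2 i ≤ ∑ s, ((p.2.2 ∘ g) ᵥ* (block p.1 f g)⁻¹) s * p.1 i (f s)} := fun i =>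
    measurableSet_le (by fun_prop) (Finset.measurable_sum _ fun s _ =>
      Measurable.mul (hy s) (by fun_prop))
  convert h1.compl.inter ((MeasurableSet.iInter h2).inter ((MeasurableSet.iInter h3).inter
    ((MeasurableSet.iInter fun j => MeasurableSet.iInter fun _ : j ∉ Set.range f => h4 j).inter
    (MeasurableSet.iInter fun i => MeasurableSet.iInter fun _ : i ∉ Set.range g => h5 i)))) using 1
  ext p
  simp only [Set.mem_ofPred_eq, Set.mem_inter_iff, Set.mem_compl_iff, Set.mem_iInter]
  constructor
  · exact fun h => ⟨h.1, h.4, h.5, h.6, h.7⟩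
  · rintro ⟨h1, h2, h3, h4, h5⟩
    refine ⟨h1, ?_, ?_, h2, h3, h4, h5⟩
    · rw [Matrix.mulVec_mulVec, Matrix.mul_nonsing_inv _ (isUnit_iff_ne_zero.2 h1),
        Matrix.one_mulVec]
    · rw [Matrix.vecMul_vecMul, Matrix.nonsing_inv_mul _ (isUnit_iff_ne_zero.2 h1),
        Matrix.vecMul_one]

theorem measurableSet_optimalBasis :
    MeasurableSet (optimalBasis f g : Set ((Fin n → Fin m → ℝ) × (Fin m → ℝ) × (Fin n → ℝ))) := by
  convert measurableSet_isBasicSolution f g using 1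
  ext p
  refine ⟨fun ⟨x, y, h⟩ => ?_, fun h => ⟨_, _, h⟩⟩
  rw [h.primal_eq, h.dual_eq] at h
  exact h

theorem measurableSet_smallHeight (k : κ) (ε : ℝ) :
    MeasurableSet (smallHeight f g k ε :
      Set ((Fin n → Fin m → ℝ) × (Fin m → ℝ) × (Fin n → ℝ))) := by
  convert (measurableSet_isBasicSolution f g).inter (measurableSet_le
    (measurable_scaledHeight (measurable_block f g) (measurable_primalSolution f g)
      (measurable_dualSolution f g) k) (measurable_const (a := ε))) using 1
  ext p
  refine ⟨fun ⟨x, y, h, h'⟩ => ?_, fun h => ⟨_, _, h.1, h.2⟩⟩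
  have hx := h.primal_eq
  have hy := h.dual_eq
  rw [hx, hy] at h h'
  exact ⟨h, h'⟩

end

end SmoothedLP

/-! ### The scaling of a whole program and its effect on the density. -/

namespace SmoothedLP

theorem extend_dotProduct {ι κ : Type*} [Fintype ι] [Fintype κ] {f : κ → ι}
    (hf : Function.Injective f) (q : κ → ℝ) (v : ι → ℝ) :
    Function.extend f q 0 ⬝ᵥ v = q ⬝ᵥ (v ∘ f) := by
  refine (Fintype.sum_of_injective f hf _ _ (fun i hi => ?_) fun r => ?_).symm
  · rw [Function.extend_apply' _ _ _ (by simpa using hi), Pi.zero_apply, zero_mul]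
  · rw [hf.extend_apply, Function.comp_apply]

theorem extend_dotProduct_self {ι κ : Type*} [Fintype ι] [Fintype κ] {f : κ → ι}
    (hf : Function.Injective f) (q : κ → ℝ) :
    Function.extend f q 0 ⬝ᵥ Function.extend f q 0 = q ⬝ᵥ q := by
  rw [extend_dotProduct hf, Function.extend_comp hf]

theorem scaleAlong_extend_comp {ι κ : Type*} [Fintype ι] [Fintype κ] {f : κ → ι}
    (hf : Function.Injective f) (q : κ → ℝ) (l : ℝ) (v : ι → ℝ) :
    scaleAlong (Function.extend f q 0) l v ∘ f = scaleAlong q l (v ∘ f) := by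
  ext s
  simp [scaleAlong, extend_dotProduct hf, hf.extend_apply]

theorem scaleAlong_extend_of_notMem {ι κ : Type*} [Fintype ι] [Fintype κ] {f : κ → ι}
    (q : κ → ℝ) (l : ℝ) (v : ι → ℝ) {j : ι} (hj : j ∉ Set.range f) :
    scaleAlong (Function.extend f q 0) l v j = v j := by
  simp [scaleAlong, Function.extend_apply' q (0 : ι → ℝ) j (by simpa using hj)]

theorem block_update {κ : Type*} [DecidableEq κ] {m n : ℕ} {C : Fin n → Fin m → ℝ} {f : κ → Fin m} {g : κ → Fin n}
    (hg : Function.Injective g) (k : κ) (a : Fin m → ℝ) :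
    block (Function.update C (g k) a) f g = (block C f g).updateCol k (a ∘ f) := by
  ext s r
  rcases eq_or_ne r k with rfl | h
  · simp [block]
  · simp [block, h, hg.ne h]

variable {κ : Type*} [Fintype κ] [DecidableEq κ] {m n : ℕ}

theorem height_scaled {B : Matrix κ κ ℝ} {k : κ} (hB : B.adjugate k ≠ 0) (l : ℝ) :
    height (B.updateCol k (scaleAlong (normal B k) l (B.col k))) k = l * height B k := by
  have : (B.updateCol k (scaleAlong (normal B k) l (B.col k))).col k =
      scaleAlong (normal B k) l (B.col k) := by
    ext i; simp
  rw [height, normal_updateCol, this, dotProduct_scaleAlong (normal_dotProduct_self hB), height]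

theorem residual_scaled {B : Matrix κ κ ℝ} {k : κ} (hB : B.adjugate k ≠ 0) (l : ℝ) :
    residual (B.updateCol k (scaleAlong (normal B k) l (B.col k))) k = residual B k := by
  have : (B.updateCol k (scaleAlong (normal B k) l (B.col k))).col k =
      scaleAlong (normal B k) l (B.col k) := by
    ext i; simp
  rw [residual, height_scaled hB, normal_updateCol, this, residual, scaleAlong,
    show normal B k ⬝ᵥ B.col k = height B k from rfl]
  ext i
  simp only [Pi.sub_apply, Pi.smul_apply, smul_eq_mul]
  ring

theorem scaledHeight_scaled {B : Matrix κ κ ℝ} {k : κ} (hB : B.adjugate k ≠ 0) {l : ℝ}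
    (hl : 0 ≤ l) (x y : κ → ℝ) :
    scaledHeight (B.updateCol k (scaleAlong (normal B k) l (B.col k))) k x y =
      l * scaledHeight B k x y := by
  rw [scaledHeight, height_scaled hB, residual_scaled hB, abs_mul, abs_of_nonneg hl, scaledHeight,
    mul_assoc]

/-- The unit normal of the `k`-th column of the block, as a vector indexed by all rows. -/
noncomputable def fullNormal (C : Fin n → Fin m → ℝ) (f : κ → Fin m) (g : κ → Fin n) (k : κ) :
    Fin m → ℝ :=
  Function.extend f (normal (block C f g) k) 0

/-- The change of the cost coefficient of the `k`-th basic column that compensates the scaling of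
this column, as a multiple of the linear functional given by this vector. -/
noncomputable def costFunctional (C : Fin n → Fin m → ℝ) (f : κ → Fin m) (g : κ → Fin n) (k : κ) :
    Fin n → ℝ :=
  height (block C f g) k • Function.extend g ((block C f g)⁻¹ *ᵥ normal (block C f g) k) 0

variable {C : Fin n → Fin m → ℝ} {f : κ → Fin m} {g : κ → Fin n} {k : κ} {b : Fin m → ℝ}
  {c : Fin n → ℝ} {x y : κ → ℝ}

theorem fullNormal_update (hg : Function.Injective g) (a : Fin m → ℝ) :
    fullNormal (Function.update C (g k) a) f g k = fullNormal C f g k := by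
  rw [fullNormal, block_update hg, normal_updateCol, fullNormal]

theorem block_scaled (hf : Function.Injective f) (hg : Function.Injective g) (l : ℝ) :
    block (Function.update C (g k) (scaleAlong (fullNormal C f g k) l (C (g k)))) f g =
      (block C f g).updateCol k
        (scaleAlong (normal (block C f g) k) l ((block C f g).col k)) := by
  rw [block_update hg, fullNormal, scaleAlong_extend_comp hf]
  rfl

/-- On the block this is `solution_of_scaled_solution`. Elsewhere nothing moves: `fullNormal`
vanishes off the basic rows, and the cost changes only at a basic column. -/
theorem IsBasicSolution.of_scaled (hf : Function.Injective f) (hg : Function.Injective g)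
    (hdet : (block C f g).det ≠ 0) {l : ℝ} (hl : l ≠ 0)
    (h : IsBasicSolution f g
      (Function.update C (g k) (scaleAlong (fullNormal C f g k) l (C (g k))))
      (scaleAlong (fullNormal C f g k) l b)
      (c - (costFunctional C f g k ⬝ᵥ c) • (1 - l) • Pi.single (g k) 1) x y) :
    IsBasicSolution f g C b c x y := by
  have h2 := h.mulVec_eq
  have h3 := h.vecMul_eq
  rw [block_scaled hf hg] at h2 h3
  rw [fullNormal, scaleAlong_extend_comp hf] at h2
  obtain ⟨hx, hy⟩ := solution_of_scaled_solution (c := c ∘ g) hdet hl h2 (by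
    rw [h3, costFunctional, smul_dotProduct, extend_dotProduct hg]
    ext r
    simp only [Function.comp_apply, Pi.sub_apply, Pi.smul_apply, smul_eq_mul, Pi.single_apply,
      hg.eq_iff]
    ring)
  refine ⟨hdet, hx, hy, h.primal_pos, h.dual_pos, fun j hj => ?_, fun i hi => ?_⟩
  · have h6 := h.primal_le j hj
    rw [fullNormal, scaleAlong_extend_of_notMem _ _ _ hj] at h6
    refine le_of_eq_of_le (Finset.sum_congr rfl fun r _ => ?_) h6
    rcases eq_or_ne r k with rfl | hr
    · rw [Function.update_self, scaleAlong_extend_of_notMem _ _ _ hj]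
    · rw [Function.update_of_ne (hg.ne hr)]
  · have h7 := h.dual_le i hi
    have hik : i ≠ g k := fun e => hi ⟨k, e.symm⟩
    simpa [hik] using h7

theorem abs_dotProduct_le_one {ι : Type*} [Fintype ι] {q a : ι → ℝ} (hq : q ⬝ᵥ q = 1)
    (ha : a ⬝ᵥ a ≤ 1) : |q ⬝ᵥ a| ≤ 1 := by
  refine (abs_dotProduct_le q a).trans ?_
  rw [hq, Real.sqrt_one, one_mul]
  exact Real.sqrt_le_one.2 ha

/-- With η = y · q, the three displaced components are t for the column, x_k t for b (as b = B x on
the basic rows) and η t for c_k. The exponent thus has the shape treated in `exponent_le_one`. -/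
theorem densityRatio_le (hf : Function.Injective f) (hg : Function.Injective g)
    (h : IsBasicSolution f g C b c x y) {σ l : ℝ} (hσ : 0 < σ) (hσ1 : σ ^ 2 ≤ 1) (hl0 : 0 ≤ l)
    (hl1 : l ≤ 1) (hs : scaledHeight (block C f g) k x y ≤ σ ^ 2) {a₀ b₀ : Fin m → ℝ}
    {c₀ : Fin n → ℝ} (ha₀ : a₀ ⬝ᵥ a₀ ≤ 1) (hb₀ : b₀ ⬝ᵥ b₀ ≤ 1) (hc₀ : |c₀ (g k)| ≤ 1) :
    densityRatio a₀ σ (C (g k)) (scaleAlong (fullNormal C f g k) l (C (g k))) *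
      densityRatio b₀ σ b (scaleAlong (fullNormal C f g k) l b) *
      densityRatio c₀ σ c (c - (costFunctional C f g k ⬝ᵥ c) • (1 - l) • Pi.single (g k) 1) ≤
      Real.exp 1 := by
  have hdet := h.det_ne_zero
  have hq := normal_dotProduct_self (adjugate_ne_zero hdet k)
  have hQ : fullNormal C f g k ⬝ᵥ fullNormal C f g k = 1 := by
    rw [fullNormal, extend_dotProduct_self hf, hq]
  have hQa : fullNormal C f g k ⬝ᵥ C (g k) = height (block C f g) k := by
    rw [fullNormal, extend_dotProduct hf]; rfl
  have hQb : fullNormal C f g k ⬝ᵥ b = x k * height (block C f g) k := by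
    rw [fullNormal, extend_dotProduct hf, ← h.mulVec_eq, Matrix.dotProduct_mulVec, normal_vecMul,
      smul_dotProduct, single_dotProduct, one_mul, smul_eq_mul, mul_comm]
  set B := block C f g with hBdef
  set t := height B k with ht
  set η := y ⬝ᵥ normal B k with hη
  have hZc : costFunctional C f g k ⬝ᵥ c = t * η := by
    rw [costFunctional, smul_dotProduct, extend_dotProduct hg, ← h.vecMul_eq, dotProduct_comm,
      ← Matrix.dotProduct_mulVec, Matrix.mulVec_mulVec,
      Matrix.mul_nonsing_inv _ (isUnit_iff_ne_zero.2 hdet), Matrix.one_mulVec, smul_eq_mul]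
  -- Separating η t from c_k leaves the effective centre c₀_k - y · residual, of size at most 1 +
  -- ‖y‖ W.
  have hck : c (g k) = y ⬝ᵥ residual B k + η * t := by
    have : c (g k) = y ⬝ᵥ B.col k := by
      rw [← Function.comp_apply (f := c) (g := g), ← h.vecMul_eq]
      rfl
    rw [this, residual, dotProduct_sub, dotProduct_smul, smul_eq_mul]
    ring
  have hW := Real.sqrt_nonneg (residual B k ⬝ᵥ residual B k)
  have key := exponent_le_one (t := t) (l := l) (X := √(x ⬝ᵥ x)) (xk := x k) (η := η)
    (Y := √(y ⬝ᵥ y)) (α := fullNormal C f g k ⬝ᵥ a₀) (β := fullNormal C f g k ⬝ᵥ b₀)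
    (δ := c₀ (g k) - y ⬝ᵥ residual B k) (W := √(residual B k ⬝ᵥ residual B k)) hσ hσ1 hl0 hl1
    (Real.sqrt_nonneg _) hW
    (Real.abs_le_sqrt (by
      rw [sq]
      exact Finset.single_le_sum (f := fun i => x i * x i) (fun i _ => mul_self_nonneg _)
        (Finset.mem_univ k)))
    (by simpa [hq] using abs_dotProduct_le y (normal B k))
    (abs_dotProduct_le_one hQ ha₀) (abs_dotProduct_le_one hQ hb₀)
    ((abs_sub _ _).trans (add_le_add hc₀ (abs_dotProduct_le _ _)))
    (by
      rw [Real.sq_sqrt (dotProduct_self_nonneg' _), Real.sq_sqrt (dotProduct_self_nonneg' _)]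
      exact hs)
  rw [densityRatio, densityRatio, densityRatio, ← Real.exp_add, ← Real.exp_add]
  refine Real.exp_le_exp.2 (le_of_eq_of_le ?_ key)
  rw [scaleAlong_density hQ, scaleAlong_density hQ, hQa, hQb, hZc, ← add_div, ← add_div]
  congr 2
  have : c - (t * η) • (1 - l) • Pi.single (g k) 1 - c₀ =
      (c - c₀) - (t * η * (1 - l)) • Pi.single (g k) 1 := by
    rw [smul_smul]; abel
  rw [this]
  simp only [sub_dotProduct (c - c₀), dotProduct_sub _ (c - c₀), smul_dotProduct, dotProduct_smul,
    single_dotProduct, dotProduct_single, smul_eq_mul, Pi.single_eq_same, one_mul, mul_one,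
    Pi.sub_apply, Pi.smul_apply, hck]
  ring

end SmoothedLP

/-! ### The change of variables for a fixed basis and column. -/

namespace SmoothedLP

variable {κ : Type*} [Fintype κ] [DecidableEq κ] {m n : ℕ}
  {f : κ → Fin m} {g : κ → Fin n} {k : κ}

/-- The data `(A, b, c)` of a linear program, where `A` is recorded by its columns. -/
abbrev ColumnProgram (m n : ℕ) : Type := (Fin n → Fin m → ℝ) × (Fin m → ℝ) × (Fin n → ℝ)

theorem rankOneUpdate_mulVec_eq_scaleAlong {ι : Type*} [Fintype ι] [DecidableEq ι] (q : ι → ℝ)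
    (l : ℝ) (v : ι → ℝ) : rankOneUpdate ((1 - l) • q) q *ᵥ v = scaleAlong q l v := by
  rw [rankOneUpdate_mulVec, scaleAlong, smul_smul, mul_comm]

theorem det_rankOneUpdate_smul {ι : Type*} [Fintype ι] [DecidableEq ι] {u w : ι → ℝ} (l : ℝ)
    (h : w ⬝ᵥ u = 1) : (rankOneUpdate ((1 - l) • u) w).det = l := by
  rw [det_rankOneUpdate, dotProduct_smul, h, smul_eq_mul]
  ring

theorem costFunctional_apply {C : Fin n → Fin m → ℝ} (hg : Function.Injective g)
    (hdet : (block C f g).det ≠ 0) :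
    costFunctional C f g k ⬝ᵥ Pi.single (g k) 1 = 1 := by
  rw [costFunctional, dotProduct_single, mul_one, Pi.smul_apply, hg.extend_apply, smul_eq_mul]
  have h := normal_dotProduct_self (adjugate_ne_zero hdet k)
  have h2 : normal (block C f g) k ⬝ᵥ (block C f g *ᵥ ((block C f g)⁻¹ *ᵥ normal (block C f g) k)) =
      height (block C f g) k * ((block C f g)⁻¹ *ᵥ normal (block C f g) k) k := by
    rw [Matrix.dotProduct_mulVec, normal_vecMul, smul_dotProduct, single_dotProduct, one_mul,
      smul_eq_mul]
  rw [← h2, Matrix.mulVec_mulVec, Matrix.mul_nonsing_inv _ (isUnit_iff_ne_zero.2 hdet),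
    Matrix.one_mulVec, h]

theorem indicator_eq_zero_of_det {C : Fin n → Fin m → ℝ} (hdet : (block C f g).det = 0) (ε : ℝ)
    (b : Fin m → ℝ) (c : Fin n → ℝ) :
    (smallHeight f g k ε).indicator (1 : ColumnProgram m n → ℝ≥0∞) (C, b, c) = 0 :=
  Set.indicator_of_notMem (s := smallHeight f g k ε)
    (fun ⟨_, _, h, _⟩ => h.det_ne_zero hdet) (1 : ColumnProgram m n → ℝ≥0∞)

/-- The substitution that scales a column along its normal, with the column fixed. -/
theorem lintegral_scaled_column_le (hf : Function.Injective f) (hg : Function.Injective g)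
    {σ l : ℝ} (hσ : 0 < σ) (hσ1 : σ ^ 2 ≤ 1) (hl0 : 0 < l) (hl1 : l ≤ 1) {a₀ b₀ : Fin m → ℝ}
    {c₀ : Fin n → ℝ} (ha₀ : a₀ ⬝ᵥ a₀ ≤ 1) (hb₀ : b₀ ⬝ᵥ b₀ ≤ 1) (hc₀ : |c₀ (g k)| ≤ 1)
    {C : Fin n → Fin m → ℝ} (hadj : (block C f g).adjugate k ≠ 0) :
    (∫⁻ b, ∫⁻ c, (smallHeight f g k (l * σ ^ 2)).indicator 1
        (Function.update C (g k) (scaleAlong (fullNormal C f g k) l (C (g k))), b, c)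
        ∂gaussianVec c₀ σ ∂gaussianVec b₀ σ) *
      ENNReal.ofReal (densityRatio a₀ σ (C (g k)) (scaleAlong (fullNormal C f g k) l (C (g k)))) ≤
    ENNReal.ofReal (l ^ 2 * Real.exp 1) *
      ∫⁻ b, ∫⁻ c, (optimalBasis f g).indicator 1 (C, b, c)
        ∂gaussianVec c₀ σ ∂gaussianVec b₀ σ := by
  set C' := Function.update C (g k) (scaleAlong (fullNormal C f g k) l (C (g k))) with hC'
  have hblock : block C' f g = _ := block_scaled hf hg l
  have hh := height_scaled hadj l
  rw [← hblock] at hh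
  -- The height of the scaled block is l times the old one, so a singular block stays singular and
  -- contributes nothing.
  by_cases hdet : (block C f g).det = 0
  · have hdet' : (block C' f g).det = 0 := by
      rw [det_eq_zero_iff_height (k := k), hh, (det_eq_zero_iff_height hadj).1 hdet, mul_zero]
      rwa [hblock, adjugate_updateCol_self]
    simp [indicator_eq_zero_of_det hdet']
  have hmeas : Measurable ((smallHeight f g k (l * σ ^ 2)).indicator
      (1 : ColumnProgram m n → ℝ≥0∞)) :=
    measurable_one.indicator (measurableSet_smallHeight f g k _)
  have hQ : fullNormal C f g k ⬝ᵥ fullNormal C f g k = 1 := by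
    rw [fullNormal, extend_dotProduct_self hf, normal_dotProduct_self hadj]
  have hP := det_rankOneUpdate_smul l hQ
  have hM := det_rankOneUpdate_smul l (costFunctional_apply (k := k) hg hdet)
  have hb : Measurable fun b => ∫⁻ c, (smallHeight f g k (l * σ ^ 2)).indicator
      (1 : ColumnProgram m n → ℝ≥0∞) (C', b, c)
      ∂gaussianVec c₀ σ :=
    Measurable.lintegral_prod_right' (f := fun z : (Fin m → ℝ) × (Fin n → ℝ) =>
      (smallHeight f g k (l * σ ^ 2)).indicator 1 (C', z)) (hmeas.comp (by fun_prop))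
  rw [lintegral_gaussianVec_substitution b₀ hσ _ (hP.symm ▸ hl0) hb, hP, mul_assoc,
    ← lintegral_mul_const' _ _ ENNReal.ofReal_ne_top,
    show l ^ 2 * Real.exp 1 = l * (l * Real.exp 1) by ring, ENNReal.ofReal_mul hl0.le, mul_assoc,
    ← lintegral_const_mul' (ENNReal.ofReal (l * Real.exp 1)) _ ENNReal.ofReal_ne_top]
  refine mul_le_mul' le_rfl (lintegral_mono fun b => ?_)
  -- The cost functional depends on the matrix, which is fixed here; integrating over c inside b
  -- keeps each substitution linear.
  rw [lintegral_gaussianVec_substitution c₀ hσ _ (hM.symm ▸ hl0) (F := fun c =>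
      (smallHeight f g k (l * σ ^ 2)).indicator (1 : ColumnProgram m n → ℝ≥0∞) (C', _, c))
      (hmeas.comp (by fun_prop)), hM,
    ENNReal.ofReal_mul hl0.le, mul_assoc, mul_assoc, mul_assoc,
    ← lintegral_mul_const' _ _ (ENNReal.mul_ne_top ENNReal.ofReal_ne_top ENNReal.ofReal_ne_top),
    ← lintegral_const_mul' (ENNReal.ofReal (Real.exp 1)) _ ENNReal.ofReal_ne_top]
  refine mul_le_mul' le_rfl (lintegral_mono fun c => ?_)
  beta_reduce
  rw [rankOneUpdate_mulVec_eq_scaleAlong, rankOneUpdate_mulVec]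
  by_cases hmem : (C', scaleAlong (fullNormal C f g k) l b,
      c - (costFunctional C f g k ⬝ᵥ c) • (1 - l) • Pi.single (g k) 1) ∈
        smallHeight f g k (l * σ ^ 2)
  · obtain ⟨x, y, h, hs⟩ := id hmem
    have h' := h.of_scaled hf hg hdet hl0.ne'
    have hs' : scaledHeight (block C f g) k x y ≤ σ ^ 2 := by
      dsimp only at hs
      rw [hblock, scaledHeight_scaled hadj hl0.le] at hs
      exact le_of_mul_le_mul_left hs hl0
    rw [Set.indicator_of_mem hmem, Set.indicator_of_mem (show (C, b, c) ∈ optimalBasis f g from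
      ⟨x, y, h'⟩)]
    simp only [Pi.one_apply, one_mul, mul_one]
    have hn : ∀ {ι : Type} [Fintype ι] (a x x' : ι → ℝ), 0 ≤ densityRatio a σ x x' :=
      fun _ _ _ => (Real.exp_pos _).le
    rw [← ENNReal.ofReal_mul (hn _ _ _), ← ENNReal.ofReal_mul (hn _ _ _)]
    refine ENNReal.ofReal_le_ofReal (le_of_eq_of_le ?_
      (densityRatio_le hf hg h' hσ hσ1 hl0.le hl1 hs' ha₀ hb₀ hc₀))
    ring
  · simp [Set.indicator_of_notMem hmem]

/-- The law of the program `(A, b, c)`, where `A` is recorded by its columns. -/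
noncomputable def columnLaw (A₀ : Matrix (Fin m) (Fin n) ℝ) (b₀ : Fin m → ℝ) (c₀ : Fin n → ℝ)
    (σ : ℝ) : Measure (ColumnProgram m n) :=
  (Measure.pi fun i => gaussianVec (A₀.col i) σ).prod ((gaussianVec b₀ σ).prod (gaussianVec c₀ σ))

instance (A₀ : Matrix (Fin m) (Fin n) ℝ) (b₀ : Fin m → ℝ) (c₀ : Fin n → ℝ) (σ : ℝ) :
    IsProbabilityMeasure (columnLaw A₀ b₀ c₀ σ) := by
  unfold columnLaw; infer_instance

theorem columnLaw_apply (A₀ : Matrix (Fin m) (Fin n) ℝ) (b₀ : Fin m → ℝ) (c₀ : Fin n → ℝ)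
    (σ : ℝ) {s : Set (ColumnProgram m n)} (hs : MeasurableSet s) :
    columnLaw A₀ b₀ c₀ σ s = ∫⁻ C, ∫⁻ b, ∫⁻ c, s.indicator 1 (C, b, c)
      ∂gaussianVec c₀ σ ∂gaussianVec b₀ σ ∂Measure.pi fun i => gaussianVec (A₀.col i) σ := by
  have hm : Measurable (s.indicator
      (1 : ColumnProgram m n → ℝ≥0∞)) := measurable_one.indicator hs
  rw [← lintegral_indicator_one hs, columnLaw, lintegral_prod _ hm.aemeasurable]
  refine lintegral_congr fun C => ?_
  exact lintegral_prod (fun z => s.indicator (1 : ColumnProgram m n → ℝ≥0∞) (C, z))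
    (hm.comp (by fun_prop)).aemeasurable

theorem measurable_lintegral_indicator {s : Set (ColumnProgram m n)}
    (hs : MeasurableSet s) (b₀ : Fin m → ℝ) (c₀ : Fin n → ℝ) (σ : ℝ) :
    Measurable fun C => ∫⁻ b, ∫⁻ c, s.indicator (1 : ColumnProgram m n → ℝ≥0∞) (C, b, c)
      ∂gaussianVec c₀ σ ∂gaussianVec b₀ σ := by
  have hm : Measurable (s.indicator
      (1 : ColumnProgram m n → ℝ≥0∞)) := measurable_one.indicator hs
  refine Measurable.lintegral_prod_right' (f := fun z : (Fin n → Fin m → ℝ) × (Fin m → ℝ) =>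
    ∫⁻ c, s.indicator (1 : ColumnProgram m n → ℝ≥0∞) (z.1, z.2, c) ∂gaussianVec c₀ σ) ?_
  exact Measurable.lintegral_prod_right'
    (f := fun z : ((Fin n → Fin m → ℝ) × (Fin m → ℝ)) × (Fin n → ℝ) =>
      s.indicator (1 : ColumnProgram m n → ℝ≥0∞) (z.1.1, z.1.2, z.2)) (hm.comp (by fun_prop))

theorem columnLaw_smallHeight_le (hf : Function.Injective f) (hg : Function.Injective g)
    {σ : ℝ} (hσ : 0 < σ) (hσ1 : σ ^ 2 ≤ 1) {A₀ : Matrix (Fin m) (Fin n) ℝ} {b₀ : Fin m → ℝ}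
    {c₀ : Fin n → ℝ} (ha₀ : A₀.col (g k) ⬝ᵥ A₀.col (g k) ≤ 1) (hb₀ : b₀ ⬝ᵥ b₀ ≤ 1)
    (hc₀ : |c₀ (g k)| ≤ 1) {ε : ℝ} (hε : 0 ≤ ε) :
    columnLaw A₀ b₀ c₀ σ (smallHeight f g k ε) ≤
      ENNReal.ofReal (ε * Real.exp 1 / σ ^ 2) * columnLaw A₀ b₀ c₀ σ (optimalBasis f g) := by
  have hσ2 : 0 < σ ^ 2 := by positivity
  rcases hε.eq_or_lt with rfl | hε
  · have : (smallHeight f g k 0 : Set (ColumnProgram m n)) = ∅ := by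
      refine Set.eq_empty_of_forall_notMem fun p ⟨x, y, h, hs⟩ => ?_
      have h0 := h.det_ne_zero
      rw [ne_eq, det_eq_zero_iff_height (adjugate_ne_zero h0 k)] at h0
      have h1 := dotProduct_self_nonneg' x
      have h2 := dotProduct_self_nonneg' y
      have h3 : 0 < |height (block p.1 f g) k| := abs_pos.2 h0
      have : 0 < scaledHeight (block p.1 f g) k x y := by unfold scaledHeight; positivity
      linarith
    rw [this, measure_empty]
    exact zero_le
  rcases lt_or_ge (σ ^ 2) ε with hlt | hle
  -- For ε > σ² the factor ε e/σ² exceeds 1 and inclusion of the events suffices.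
  · calc columnLaw A₀ b₀ c₀ σ (smallHeight f g k ε)
        ≤ 1 * columnLaw A₀ b₀ c₀ σ (optimalBasis f g) := by
          rw [one_mul]; exact measure_mono (smallHeight_subset f g k ε)
      _ ≤ _ := by
          gcongr
          rw [← ENNReal.ofReal_one]
          refine ENNReal.ofReal_le_ofReal ?_
          rw [le_div_iff₀ hσ2]
          nlinarith [Real.add_one_le_exp 1]
  set l := ε / σ ^ 2 with hl
  have hl0 : 0 < l := by positivity
  have hl1 : l ≤ 1 := (div_le_one hσ2).2 hle
  have hεl : ε = l * σ ^ 2 := by rw [hl]; field_simp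
  have hS := measurableSet_smallHeight (m := m) (n := n) f g k ε
  have hE := measurableSet_optimalBasis (m := m) (n := n) f g
  rw [columnLaw_apply _ _ _ _ hS, columnLaw_apply _ _ _ _ hE,
    ← lintegral_const_mul _ (measurable_lintegral_indicator hE b₀ c₀ σ)]
  -- Only column k is integrated out; the other columns, and with them the normal, stay fixed.
  refine lintegral_le_of_lmarginal_le {g k} (measurable_lintegral_indicator hS b₀ c₀ σ)
    ((measurable_lintegral_indicator hE b₀ c₀ σ).const_mul _) fun C => ?_
  rw [lmarginal_singleton, lmarginal_singleton]
  dsimp only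
  by_cases hadj : (block C f g).adjugate k = 0
  · have hz : ∀ a b c, (smallHeight f g k ε).indicator (1 : ColumnProgram m n → ℝ≥0∞)
        (Function.update C (g k) a, b, c) = 0 := fun a b c => by
      refine indicator_eq_zero_of_det ?_ ε b c
      by_contra h
      refine adjugate_ne_zero h k ?_
      rw [block_update hg, adjugate_updateCol_self, hadj]
    simp [hz]
  have hQ : fullNormal C f g k ⬝ᵥ fullNormal C f g k = 1 := by
    rw [fullNormal, extend_dotProduct_self hf, normal_dotProduct_self hadj]
  have hP := det_rankOneUpdate_smul l hQ
  rw [lintegral_gaussianVec_substitution _ hσ _ (hP.symm ▸ hl0) (F := fun a =>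
      ∫⁻ b, ∫⁻ c, (smallHeight f g k ε).indicator (1 : ColumnProgram m n → ℝ≥0∞)
        (Function.update C (g k) a, b, c) ∂gaussianVec c₀ σ ∂gaussianVec b₀ σ)
    ((measurable_lintegral_indicator hS b₀ c₀ σ).comp (measurable_update C)), hP]
  calc _ ≤ ENNReal.ofReal l * ∫⁻ a, ENNReal.ofReal (l ^ 2 * Real.exp 1) *
        ∫⁻ b, ∫⁻ c, (optimalBasis f g).indicator 1 (Function.update C (g k) a, b, c)
        ∂gaussianVec c₀ σ ∂gaussianVec b₀ σ ∂gaussianVec (A₀.col (g k)) σ := by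
        refine mul_le_mul' le_rfl (lintegral_mono fun a => ?_)
        have := lintegral_scaled_column_le (k := k) hf hg hσ hσ1 hl0 hl1 ha₀ hb₀ hc₀
          (C := Function.update C (g k) a) (by rwa [block_update hg, adjugate_updateCol_self])
        rw [Function.update_self, fullNormal_update hg, Function.update_idem, ← hεl] at this
        rwa [rankOneUpdate_mulVec_eq_scaleAlong]
    _ ≤ _ := by
        rw [lintegral_const_mul' _ _ ENNReal.ofReal_ne_top,
          lintegral_const_mul' _ _ ENNReal.ofReal_ne_top, ← mul_assoc,
          ← ENNReal.ofReal_mul hl0.le]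
        gcongr
        have h2 : l ^ 2 ≤ 1 := pow_le_one₀ hl0.le hl1
        calc l * (l ^ 2 * Real.exp 1) ≤ l * (1 * Real.exp 1) := by gcongr
          _ = ε * Real.exp 1 / σ ^ 2 := by rw [hl]; ring

end SmoothedLP

/-! ### Uniqueness of the optimal basis under nondegeneracy. -/

namespace SmoothedLP

variable {m n : ℕ}

theorem vecNorm_sq (x : Fin n → ℝ) : vecNorm x ^ 2 = x ⬝ᵥ x := by
  rw [vecNorm, EuclideanSpace.norm_sq_eq]
  simp [dotProduct, sq]

theorem dotProduct_self_le_one {x : Fin n → ℝ} (hx : vecNorm x ≤ 1) : x ⬝ᵥ x ≤ 1 := by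
  rw [← vecNorm_sq]
  exact pow_le_one₀ (norm_nonneg _) hx

theorem abs_apply_le_one {x : Fin n → ℝ} (hx : vecNorm x ≤ 1) (i : Fin n) : |x i| ≤ 1 := by
  rw [← sq_le_one_iff_abs_le_one, sq]
  exact (Finset.single_le_sum (f := fun i => x i * x i) (fun i _ => mul_self_nonneg _)
    (Finset.mem_univ i)).trans (dotProduct_self_le_one hx)

theorem vecNorm_col_le (A : Matrix (Fin m) (Fin n) ℝ) (k : Fin n) :
    vecNorm (A.col k) ≤ matNorm A := by
  have h := (LinearMap.toContinuousLinearMap (Matrix.toEuclideanLin A)).le_opNorm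
    (PiLp.single 2 k (1 : ℝ))
  rw [PiLp.norm_single, norm_one, mul_one] at h
  refine le_of_eq_of_le ?_ h
  rw [vecNorm]
  congr 1
  ext j
  simp [Matrix.toLpLin_apply]

theorem eq_extend {ι κ : Type*} {g : κ → ι} (hg : Function.Injective g) {x : ι → ℝ}
    (hx : ∀ i, i ∉ Set.range g → x i = 0) : x = Function.extend g (x ∘ g) 0 := by
  ext i
  by_cases hi : i ∈ Set.range g
  · obtain ⟨r, rfl⟩ := hi
    rw [hg.extend_apply, Function.comp_apply]
  · rw [hx i hi, Function.extend_apply' _ _ _ (by simpa using hi), Pi.zero_apply]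

theorem card_le_of_leftKernel {ι κ : Type*} [Fintype ι] [Fintype κ] [DecidableEq ι]
    (M : Matrix ι κ ℝ) (T : Finset ι) (U : Finset κ)
    (h : ∀ w : ι → ℝ, (∀ j ∉ T, w j = 0) → (∀ i ∈ U, (w ᵥ* M) i = 0) → w = 0) :
    T.card ≤ U.card := by
  let L : (T → ℝ) →ₗ[ℝ] (U → ℝ) := (M.submatrix (Subtype.val : T → ι) Subtype.val).vecMulLinear
  have hL : Function.Injective L := by
    refine (injective_iff_map_eq_zero L).2 fun w hw => ?_
    have := h (Function.extend Subtype.val w 0)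
      (fun j hj => Function.extend_apply' _ _ _ (by rintro ⟨a, rfl⟩; exact hj a.2))
      (fun i hi => by
        have h1 := congrFun hw ⟨i, hi⟩
        rw [Matrix.vecMul, extend_dotProduct Subtype.val_injective]
        exact h1)
    ext j
    have := congrFun this j
    rwa [Subtype.val_injective.extend_apply] at this
  simpa using LinearMap.finrank_le_finrank_of_injective hL

section Nondegenerate

variable {A : Matrix (Fin m) (Fin n) ℝ} {b : Fin m → ℝ} {c : Fin n → ℝ}

theorem Nondegenerate.card_tight_le (h : Nondegenerate A b c) {T : Finset (Fin m)}
    {U : Finset (Fin n)} {x : Fin n → ℝ} (hx : ∀ i ∉ U, x i = 0)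
    (hT : ∀ j ∈ T, (A *ᵥ x) j = b j) : T.card ≤ U.card :=
  card_le_of_leftKernel A T U fun w hw hw' => h.1 T U x w hx hw hT hw'

theorem Nondegenerate.card_dual_tight_le (h : Nondegenerate A b c) {T : Finset (Fin n)}
    {V : Finset (Fin m)} {y : Fin m → ℝ} (hy : ∀ j ∉ V, y j = 0)
    (hT : ∀ i ∈ T, (y ᵥ* A) i = c i) : T.card ≤ V.card :=
  card_le_of_leftKernel Aᵀ T V fun w hw hw' => h.2 T V y w hy hw hT
    (by simpa [Matrix.vecMul_transpose] using hw')

theorem mem_posSupport {x : Fin n → ℝ} {i : Fin n} : i ∈ posSupport x ↔ 0 < x i := by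
  simp [posSupport]

theorem eq_zero_of_notMem_posSupport {x : Fin n → ℝ} (hx : 0 ≤ x) :
    ∀ i ∉ posSupport x, x i = 0 := fun i hi =>
  le_antisymm (not_lt.1 fun h => hi (mem_posSupport.2 h)) (hx i)

/-- A pair of feasible solutions without duality gap. -/
structure OptimalPair (A : Matrix (Fin m) (Fin n) ℝ) (b : Fin m → ℝ) (c : Fin n → ℝ)
    (x : Fin n → ℝ) (y : Fin m → ℝ) : Prop where
  primal : PrimalFeasible A b x
  dual : DualFeasible A c y
  gap : y ⬝ᵥ b ≤ c ⬝ᵥ x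

theorem OptimalPair.mix {x x' : Fin n → ℝ} {y y' : Fin m → ℝ} (h : OptimalPair A b c x y)
    (h' : OptimalPair A b c x' y') : OptimalPair A b c x y' :=
  ⟨h.primal, h'.dual, h'.gap.trans ((weak_duality h'.primal h.dual).trans h.gap)⟩

/-- Complementary slackness makes the rows in V tight at x, so nondegeneracy gives |V| ≤ |U|; the
dual argument gives the reverse. -/
theorem OptimalPair.card_eq {x : Fin n → ℝ} {y : Fin m → ℝ} (h : OptimalPair A b c x y)
    (hN : Nondegenerate A b c) : (posSupport x).card = (posSupport y).card :=
  le_antisymm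
    (hN.card_dual_tight_le (eq_zero_of_notMem_posSupport h.dual.2) fun _ hi =>
      vecMul_eq_of_duality h.primal h.dual h.gap (mem_posSupport.1 hi))
    (hN.card_tight_le (eq_zero_of_notMem_posSupport h.primal.2) fun _ hj =>
      mulVec_eq_of_duality h.primal h.dual h.gap (mem_posSupport.1 hj))

/-- Since x is also paired with y', all rows in V ∪ V' are tight at x. Hence |V ∪ V'| ≤ |U| = |V|.
-/
theorem OptimalPair.posSupport_dual_subset {x x' : Fin n → ℝ} {y y' : Fin m → ℝ}
    (h : OptimalPair A b c x y) (h' : OptimalPair A b c x' y') (hN : Nondegenerate A b c) :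
    posSupport y' ⊆ posSupport y := by
  have h2 := h.mix h'
  have hc := hN.card_tight_le (T := posSupport y ∪ posSupport y')
    (eq_zero_of_notMem_posSupport h.primal.2) fun j hj => by
      rcases Finset.mem_union.1 hj with hj | hj
      · exact mulVec_eq_of_duality h.primal h.dual h.gap (mem_posSupport.1 hj)
      · exact mulVec_eq_of_duality h2.primal h2.dual h2.gap (mem_posSupport.1 hj)
  rw [h.card_eq hN] at hc
  rw [Finset.eq_of_subset_of_card_le Finset.subset_union_left hc]
  exact Finset.subset_union_right

theorem OptimalPair.posSupport_primal_subset {x x' : Fin n → ℝ} {y y' : Fin m → ℝ}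
    (h : OptimalPair A b c x y) (h' : OptimalPair A b c x' y') (hN : Nondegenerate A b c) :
    posSupport x' ⊆ posSupport x := by
  have h2 := h'.mix h
  have hc := hN.card_dual_tight_le (T := posSupport x ∪ posSupport x')
    (eq_zero_of_notMem_posSupport h.dual.2) fun j hj => by
      rcases Finset.mem_union.1 hj with hj | hj
      · exact vecMul_eq_of_duality h.primal h.dual h.gap (mem_posSupport.1 hj)
      · exact vecMul_eq_of_duality h2.primal h2.dual h2.gap (mem_posSupport.1 hj)
  rw [← h.card_eq hN] at hc
  rw [Finset.eq_of_subset_of_card_le Finset.subset_union_left hc]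
  exact Finset.subset_union_right

end Nondegenerate

/-- A pair of a set of columns and a set of rows of equal size. -/
abbrev BasisIndex (m n : ℕ) : Type :=
  {p : Finset (Fin n) × Finset (Fin m) // p.1.card = p.2.card}

namespace BasisIndex

/-- The rows of a basis, indexed by its columns. -/
noncomputable def row (I : BasisIndex m n) (r : I.1.1) : Fin m := Finset.equivOfCardEq I.2 r

/-- The columns of a basis. -/
def column (I : BasisIndex m n) (r : I.1.1) : Fin n := r

theorem row_injective (I : BasisIndex m n) : Function.Injective I.row :=
  Subtype.val_injective.comp (Finset.equivOfCardEq I.2).injective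

theorem column_injective (I : BasisIndex m n) : Function.Injective I.column :=
  Subtype.val_injective

theorem mem_range_row (I : BasisIndex m n) {j : Fin m} : j ∈ Set.range I.row ↔ j ∈ I.1.2 := by
  constructor
  · rintro ⟨r, rfl⟩
    exact (Finset.equivOfCardEq I.2 r).2
  · intro hj
    exact ⟨(Finset.equivOfCardEq I.2).symm ⟨j, hj⟩, by simp [row]⟩

theorem mem_range_column (I : BasisIndex m n) {i : Fin n} :
    i ∈ Set.range I.column ↔ i ∈ I.1.1 := by
  constructor
  · rintro ⟨r, rfl⟩
    exact r.2
  · intro hi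
    exact ⟨⟨i, hi⟩, rfl⟩

end BasisIndex

variable {A : Matrix (Fin m) (Fin n) ℝ} {b : Fin m → ℝ} {c : Fin n → ℝ}

theorem mulVec_extend {κ : Type*} [Fintype κ] {g : κ → Fin n}
    (hg : Function.Injective g) (x : κ → ℝ) (j : Fin m) :
    (A *ᵥ Function.extend g x 0) j = ∑ r, A j (g r) * x r := by
  rw [Matrix.mulVec, dotProduct_comm, extend_dotProduct hg, dotProduct_comm]
  rfl

theorem extend_vecMul {κ : Type*} [Fintype κ] {f : κ → Fin m}
    (hf : Function.Injective f) (y : κ → ℝ) (i : Fin n) :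
    (Function.extend f y 0 ᵥ* A) i = ∑ s, y s * A (f s) i := by
  rw [Matrix.vecMul, extend_dotProduct hf]
  rfl

theorem IsBasicSolution.optimalPair {κ : Type*} [Fintype κ] [DecidableEq κ] {f : κ → Fin m}
    {g : κ → Fin n} (hf : Function.Injective f) (hg : Function.Injective g) {x y : κ → ℝ}
    (h : IsBasicSolution f g (fun i j => A j i) b c x y) :
    OptimalPair A b c (Function.extend g x 0) (Function.extend f y 0) := by
  refine ⟨⟨fun j => ?_, fun i => ?_⟩, ⟨fun i => ?_, fun j => ?_⟩, ?_⟩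
  · rw [mulVec_extend hg]
    by_cases hj : j ∈ Set.range f
    · obtain ⟨s, rfl⟩ := hj
      exact (congrFun h.mulVec_eq s).le
    · exact h.primal_le j hj
  · by_cases hi : i ∈ Set.range g
    · obtain ⟨r, rfl⟩ := hi
      rw [hg.extend_apply]
      exact (h.primal_pos r).le
    · rw [Function.extend_apply' _ _ _ (by simpa using hi)]
  · rw [extend_vecMul hf]
    by_cases hi : i ∈ Set.range g
    · obtain ⟨r, rfl⟩ := hi
      exact (congrFun h.vecMul_eq r).ge
    · exact h.dual_le i hi
  · by_cases hj : j ∈ Set.range f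
    · obtain ⟨s, rfl⟩ := hj
      rw [hf.extend_apply]
      exact (h.dual_pos s).le
    · rw [Function.extend_apply' _ _ _ (by simpa using hj)]
  · rw [extend_dotProduct hf, dotProduct_comm c, extend_dotProduct hg, ← h.mulVec_eq,
      ← h.vecMul_eq, dotProduct_comm x, Matrix.dotProduct_mulVec]

theorem posSupport_extend {κ : Type*} {g : κ → Fin n} (hg : Function.Injective g) {x : κ → ℝ}
    (hx : ∀ r, 0 < x r) {i : Fin n} :
    i ∈ posSupport (Function.extend g x 0) ↔ i ∈ Set.range g := by
  rw [mem_posSupport]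
  by_cases hi : i ∈ Set.range g
  · obtain ⟨r, rfl⟩ := hi
    simp [hg.extend_apply, hx r]
  · rw [Function.extend_apply' _ _ _ (by simpa using hi)]
    simp [hi]

theorem BasisIndex.eq_of_optimal (hN : Nondegenerate A b c) {I J : BasisIndex m n}
    (hI : ((fun i j => A j i, b, c) : ColumnProgram m n) ∈ optimalBasis I.row I.column)
    (hJ : ((fun i j => A j i, b, c) : ColumnProgram m n) ∈ optimalBasis J.row J.column) :
    I = J := by
  have key : ∀ {I J : BasisIndex m n},
      ((fun i j => A j i, b, c) : ColumnProgram m n) ∈ optimalBasis I.row I.column →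
      ((fun i j => A j i, b, c) : ColumnProgram m n) ∈ optimalBasis J.row J.column →
      J.1.1 ⊆ I.1.1 ∧ J.1.2 ⊆ I.1.2 := by
    rintro I J ⟨x, y, h⟩ ⟨x', y', h'⟩
    have hO := h.optimalPair I.row_injective I.column_injective
    have hO' := h'.optimalPair J.row_injective J.column_injective
    refine ⟨fun i hi => ?_, fun j hj => ?_⟩
    · rw [← I.mem_range_column, ← posSupport_extend I.column_injective h.primal_pos]
      refine hO.posSupport_primal_subset hO' hN ?_
      rwa [posSupport_extend J.column_injective h'.primal_pos, J.mem_range_column]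
    · rw [← I.mem_range_row, ← posSupport_extend I.row_injective h.dual_pos]
      refine hO.posSupport_dual_subset hO' hN ?_
      rwa [posSupport_extend J.row_injective h'.dual_pos, J.mem_range_row]
  obtain ⟨h1, h2⟩ := key hI hJ
  obtain ⟨h3, h4⟩ := key hJ hI
  exact Subtype.ext (Prod.ext (h3.antisymm h1) (h4.antisymm h2))

/-- The basis of a nondegenerate pair of optimal solutions. -/
theorem OptimalPair.isBasicSolution {x : Fin n → ℝ} {y : Fin m → ℝ}
    (h : OptimalPair A b c x y) (hN : Nondegenerate A b c) (I : BasisIndex m n)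
    (hI1 : I.1.1 = posSupport x) (hI2 : I.1.2 = posSupport y) :
    IsBasicSolution I.row I.column (fun i j => A j i) b c (x ∘ I.column) (y ∘ I.row) := by
  have hx : x = Function.extend I.column (x ∘ I.column) 0 :=
    eq_extend I.column_injective fun i hi => eq_zero_of_notMem_posSupport h.primal.2 i
      (by rwa [I.mem_range_column, hI1] at hi)
  have hy : y = Function.extend I.row (y ∘ I.row) 0 :=
    eq_extend I.row_injective fun j hj => eq_zero_of_notMem_posSupport h.dual.2 j
      (by rwa [I.mem_range_row, hI2] at hj)
  have hU : ∀ r, I.column r ∈ posSupport x := fun r =>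
    hI1 ▸ I.mem_range_column.1 (Set.mem_range_self r)
  have hV : ∀ r, I.row r ∈ posSupport y := fun r =>
    hI2 ▸ I.mem_range_row.1 (Set.mem_range_self r)
  have hyA : ∀ i ∈ posSupport x, (y ᵥ* A) i = c i := fun i hi =>
    vecMul_eq_of_duality h.primal h.dual h.gap (mem_posSupport.1 hi)
  refine ⟨fun hdet => ?_, ?_, ?_, fun r => mem_posSupport.1 (hU r),
    fun s => mem_posSupport.1 (hV s), fun j _ => ?_, fun i _ => ?_⟩
  -- A kernel vector of the block, extended by zero, is killed by the rows in V and supported on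
  -- columns tight for y, against dual nondegeneracy.
  · obtain ⟨v, hv0, hv⟩ := Matrix.exists_mulVec_eq_zero_iff.2 hdet
    refine hv0 ?_
    have := hN.2 (posSupport x) (posSupport y) y (Function.extend I.column v 0)
      (eq_zero_of_notMem_posSupport h.dual.2) (fun i hi => Function.extend_apply' _ _ _ (by
        rintro ⟨r, rfl⟩; exact hi (hU r))) hyA (fun j hj => by
        rw [← hI2, ← I.mem_range_row] at hj
        obtain ⟨s, rfl⟩ := hj
        rw [mulVec_extend I.column_injective]
        exact congrFun hv s)
    ext r
    rw [← I.column_injective.extend_apply v 0 r, this]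
    rfl
  · ext s
    have := mulVec_eq_of_duality h.primal h.dual h.gap (mem_posSupport.1 (hV s))
    rw [hx, mulVec_extend I.column_injective] at this
    exact this
  · ext r
    have := hyA _ (hU r)
    rw [hy, extend_vecMul I.row_injective] at this
    exact this
  · have := h.primal.1 j
    rw [hx, mulVec_extend I.column_injective] at this
    exact this
  · have := h.dual.1 i
    rw [hy, extend_vecMul I.row_injective] at this
    exact this

end SmoothedLP

/-! ### From γ to the height of a column in a basis. -/

namespace SmoothedLP

variable {m n : ℕ} {A : Matrix (Fin m) (Fin n) ℝ} {b : Fin m → ℝ} {c : Fin n → ℝ}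

/-- The inner product with the unit normal is 1-Lipschitz, vanishes on the other columns and equals
the height at column k. Only this inequality is needed. -/
theorem abs_height_le_infEDist (I : BasisIndex m n)
    (hdet : (block (fun i j => A j i) I.row I.column).det ≠ 0) (k : I.1.1) :
    ENNReal.ofReal |height (block (fun i j => A j i) I.row I.column) k| ≤
      Metric.infEDist (subColumn A I.1.2 k)
        (Submodule.span ℝ (subColumn A I.1.2 '' ((I.1.1.erase k : Finset (Fin n)) :
          Set (Fin n))) : Set (EuclideanSpace ℝ I.1.2)) := by
  set B := block (fun i j => A j i) I.row I.column with hB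
  have hq := normal_dotProduct_self (adjugate_ne_zero hdet k)
  let e := Finset.equivOfCardEq I.2
  let Φ : EuclideanSpace ℝ I.1.2 →ₗ[ℝ] ℝ :=
    ∑ s, normal B k s • (LinearMap.proj (e s) ∘ₗ (WithLp.linearEquiv 2 ℝ (I.1.2 → ℝ)).toLinearMap)
  have hΦ : ∀ v, Φ v = normal B k ⬝ᵥ (fun s => v (e s)) := fun v => by
    simp [Φ, dotProduct]
  have hcol : ∀ l : I.1.1, Φ (subColumn A I.1.2 l) = (normal B k ᵥ* B) l := fun l => by
    rw [hΦ]; rfl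
  have hbound : ∀ v, |Φ v| ≤ ‖v‖ := fun v => by
    rw [hΦ]
    refine (abs_dotProduct_le _ _).trans ?_
    rw [hq, Real.sqrt_one, one_mul, EuclideanSpace.norm_eq]
    refine Real.sqrt_le_sqrt (le_of_eq ?_)
    rw [dotProduct, ← e.sum_comp]
    exact Finset.sum_congr rfl fun s _ => by rw [Real.norm_eq_abs, sq_abs, sq]
  have hspan : Submodule.span ℝ (subColumn A I.1.2 '' ((I.1.1.erase k : Finset (Fin n)) :
      Set (Fin n))) ≤ LinearMap.ker Φ := by
    rw [Submodule.span_le]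
    rintro _ ⟨l, hl, rfl⟩
    obtain ⟨hlk, hl⟩ := Finset.mem_erase.1 (Finset.mem_coe.1 hl)
    rw [SetLike.mem_coe, LinearMap.mem_ker, hcol ⟨l, hl⟩, normal_vecMul, Pi.smul_apply,
      Pi.single_eq_of_ne (fun h => hlk (congrArg Subtype.val h)), smul_zero]
  rw [Metric.le_infEDist]
  intro z hz
  have h0 : Φ z = 0 := hspan hz
  rw [edist_dist, dist_eq_norm]
  refine ENNReal.ofReal_le_ofReal (le_trans (le_of_eq ?_) (hbound _))
  rw [map_sub, h0, sub_zero, hcol, normal_vecMul, Pi.smul_apply, Pi.single_eq_same, smul_eq_mul,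
    mul_one]

/-- By Pythagoras the projection is no longer than the column of the block, which is part of a
column of A. -/
theorem sqrt_residual_le (I : BasisIndex m n)
    (hdet : (block (fun i j => A j i) I.row I.column).det ≠ 0) (k : I.1.1) :
    √(residual (block (fun i j => A j i) I.row I.column) k ⬝ᵥ
      residual (block (fun i j => A j i) I.row I.column) k) ≤ matNorm A := by
  refine le_trans ?_ (vecNorm_col_le A k)
  refine Real.sqrt_le_iff.2 ⟨norm_nonneg _, ?_⟩
  rw [vecNorm_sq]
  set B := block (fun i j => A j i) I.row I.column with hB
  have hq := normal_dotProduct_self (adjugate_ne_zero hdet k)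
  have h1 : residual B k ⬝ᵥ residual B k = B.col k ⬝ᵥ B.col k - height B k ^ 2 := by
    have h2 : normal B k ⬝ᵥ B.col k = height B k := rfl
    simp only [residual, sub_dotProduct, dotProduct_sub, smul_dotProduct, dotProduct_smul,
      smul_eq_mul, hq, dotProduct_comm (B.col k) (normal B k), h2]
    ring
  rw [h1]
  refine (sub_le_self _ (sq_nonneg _)).trans ?_
  have h3 : B.col k ⬝ᵥ B.col k =
      ∑ j ∈ Finset.univ.image I.row, A.col k j * A.col k j := by
    rw [Finset.sum_image fun _ _ _ _ h => I.row_injective h]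
    rfl
  rw [h3]
  exact Finset.sum_le_sum_of_subset_of_nonneg (Finset.subset_univ _)
    fun _ _ _ => mul_self_nonneg _

/-- A finite bound rules out empty U, where γ = ∞; over a nonempty finite set the infimum is
attained. -/
theorem exists_infEDist_le {U : Finset (Fin n)} {V : Finset (Fin m)} {r : ℝ}
    (h : gammaUV A U V ≤ ENNReal.ofReal r) :
    ∃ k ∈ U, Metric.infEDist (subColumn A V k)
      (Submodule.span ℝ (subColumn A V '' ((U.erase k : Finset (Fin n)) : Set (Fin n))) :
        Set (EuclideanSpace ℝ V)) ≤ ENNReal.ofReal r := by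
  by_contra! hcon
  refine not_lt.2 h ?_
  rw [gammaUV, ← Finset.inf_eq_iInf, Finset.lt_inf_iff ENNReal.ofReal_lt_top]
  exact hcon

theorem exists_smallHeight (hN : Nondegenerate A b c) {ε : ℝ} (hε : 0 ≤ ε) {x : Fin n → ℝ}
    {y : Fin m → ℝ} (hx : IsPrimalOptimal A b c x) (hy : IsDualOptimal A b c y)
    (h : gammaUV A (posSupport x) (posSupport y) ≤
      ENNReal.ofReal (ε / ((1 + vecNorm x ^ 2 + vecNorm y ^ 2) * (matNorm A + 3)))) :
    ∃ (I : BasisIndex m n) (k : I.1.1),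
      ((fun i j => A j i, b, c) : ColumnProgram m n) ∈ smallHeight I.row I.column k ε := by
  have hO : OptimalPair A b c x y := ⟨hx.1, hy.1, strong_duality hx hy⟩
  let I : BasisIndex m n := ⟨(posSupport x, posSupport y), hO.card_eq hN⟩
  have hbasic := hO.isBasicSolution hN I rfl rfl
  obtain ⟨k, hk, hdist⟩ := exists_infEDist_le h
  refine ⟨I, ⟨k, hk⟩, _, _, hbasic, ?_⟩
  have hA : 0 ≤ matNorm A := norm_nonneg _
  have h1 := (abs_height_le_infEDist I hbasic.det_ne_zero ⟨k, hk⟩).trans hdist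
  rw [ENNReal.ofReal_le_ofReal_iff (by positivity), le_div_iff₀ (by positivity)] at h1
  refine le_trans ?_ h1
  have hxx : vecNorm x ^ 2 = (x ∘ I.column) ⬝ᵥ (x ∘ I.column) := by
    rw [vecNorm_sq, ← extend_dotProduct_self I.column_injective, ← eq_extend I.column_injective
      fun i hi => eq_zero_of_notMem_posSupport hO.primal.2 i (by rwa [I.mem_range_column] at hi)]
  have hyy : vecNorm y ^ 2 = (y ∘ I.row) ⬝ᵥ (y ∘ I.row) := by
    rw [vecNorm_sq, ← extend_dotProduct_self I.row_injective, ← eq_extend I.row_injective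
      fun i hi => eq_zero_of_notMem_posSupport hO.dual.2 i (by rwa [I.mem_range_row] at hi)]
  have h2 := dotProduct_self_nonneg' (x ∘ I.column)
  have h3 := dotProduct_self_nonneg' (y ∘ I.row)
  rw [scaledHeight, hxx, hyy]
  gcongr
  exact sqrt_residual_le I hbasic.det_ne_zero ⟨k, hk⟩

theorem measurePreserving_columns (A₀ : Matrix (Fin m) (Fin n) ℝ) (b₀ : Fin m → ℝ)
    (c₀ : Fin n → ℝ) (σ : ℝ) :
    MeasurePreserving (fun p : (Fin m → Fin n → ℝ) × (Fin m → ℝ) × (Fin n → ℝ) =>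
      ((fun i j => p.1 j i, p.2.1, p.2.2) : ColumnProgram m n))
      (gaussianLP A₀ b₀ c₀ σ) (columnLaw A₀ b₀ c₀ σ) := by
  have h : MeasurePreserving (fun (M : Fin m → Fin n → ℝ) i j => M j i)
      (Measure.pi fun j => Measure.pi fun i => gaussianReal (A₀ j i) (Real.toNNReal (σ ^ 2)))
      (Measure.pi fun i => gaussianVec (A₀.col i) σ) :=
    ⟨by fun_prop,
      map_flip_pi_pi fun i j => gaussianReal (A₀ j i) (Real.toNNReal (σ ^ 2))⟩
  have : ∀ j, IsProbabilityMeasure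
      (Measure.pi fun i => gaussianReal (A₀ j i) (Real.toNNReal (σ ^ 2))) := fun j => inferInstance
  exact h.prod (MeasurePreserving.id _)

end SmoothedLP

/-! ### Summation over bases and columns. -/

theorem lemma6p3 (m n : ℕ) (hmn : n ≤ m)
    (A₀ : Matrix (Fin m) (Fin n) ℝ) (b₀ : Fin m → ℝ) (c₀ : Fin n → ℝ)
    (hA₀ : SmoothedLP.matNorm A₀ ≤ 1) (hb₀ : SmoothedLP.vecNorm b₀ ≤ 1)
    (hc₀ : SmoothedLP.vecNorm c₀ ≤ 1)
    (σ : ℝ) (hσ : 0 < σ) (hσ1 : σ ^ 2 ≤ 1) (ε : ℝ) (hε : 0 ≤ ε) :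
    SmoothedLP.gaussianLP A₀ b₀ c₀ σ (SmoothedLP.smallGammaEvent m n ε) ≤
      ENNReal.ofReal (ε * n * Real.exp 1 / σ ^ 2) := by
  open SmoothedLP in
  set μ := gaussianLP A₀ b₀ c₀ σ with hμ
  have hT := measurePreserving_columns A₀ b₀ c₀ σ
  rw [← hμ] at hT
  set T : (Fin m → Fin n → ℝ) × (Fin m → ℝ) × (Fin n → ℝ) → ColumnProgram m n :=
    fun p => (fun i j => p.1 j i, p.2.1, p.2.2) with hTdef
  have hμ1 : μ Set.univ = 1 := by
    rw [← Set.preimage_univ (f := T), hT.measure_preimage MeasurableSet.univ.nullMeasurableSet,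
      measure_univ]
  have hN : ∀ᵐ p ∂μ, Nondegenerate (Matrix.of p.1) p.2.1 p.2.2 := ae_nondegenerate A₀ b₀ c₀ hσ
  have hE : ∀ I : BasisIndex m n, MeasurableSet (optimalBasis I.row I.column) := fun I =>
    measurableSet_optimalBasis _ _
  have hcover : smallGammaEvent m n ε ≤ᵐ[μ]
      ⋃ I : BasisIndex m n, ⋃ k : I.1.1, T ⁻¹' smallHeight I.row I.column k ε := by
    filter_upwards [hN] with p hp hmem
    obtain ⟨-, x, y, hx, hy, h⟩ := hmem
    obtain ⟨I, k, hk⟩ := exists_smallHeight hp hε hx hy h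
    exact Set.mem_iUnion₂.2 ⟨I, k, hk⟩
  have hle : ∀ (I : BasisIndex m n) (k : I.1.1), μ (T ⁻¹' smallHeight I.row I.column k ε) ≤
      ENNReal.ofReal (ε * Real.exp 1 / σ ^ 2) * μ (T ⁻¹' optimalBasis I.row I.column) :=
    fun I k => by
      rw [hT.measure_preimage (measurableSet_smallHeight _ _ k ε).nullMeasurableSet,
        hT.measure_preimage (hE I).nullMeasurableSet]
      exact columnLaw_smallHeight_le I.row_injective I.column_injective hσ hσ1
        (dotProduct_self_le_one ((vecNorm_col_le A₀ _).trans hA₀)) (dotProduct_self_le_one hb₀)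
        (abs_apply_le_one hc₀ _) hε
  -- Two distinct bases can be optimal together only on the null set of degenerate data.
  have hsum : ∑ I : BasisIndex m n, μ (T ⁻¹' optimalBasis I.row I.column) ≤ 1 := by
    rw [← hμ1]
    refine sum_measure_le_measure_univ (fun I _ =>
      (hT.measurable (hE I)).nullMeasurableSet) fun I _ J _ hIJ => ?_
    refine measure_mono_null ?_ (ae_iff.1 hN)
    rintro p ⟨hI, hJ⟩ hp
    exact hIJ (BasisIndex.eq_of_optimal hp hI hJ)
  calc μ (smallGammaEvent m n ε)
      ≤ μ (⋃ I : BasisIndex m n, ⋃ k : I.1.1, T ⁻¹' smallHeight I.row I.column k ε) :=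
        measure_mono_ae hcover
    _ ≤ ∑ I : BasisIndex m n, ∑ k : I.1.1, μ (T ⁻¹' smallHeight I.row I.column k ε) :=
        (measure_iUnion_fintype_le _ _).trans
          (Finset.sum_le_sum fun I _ => measure_iUnion_fintype_le _ _)
    _ ≤ ∑ I : BasisIndex m n, n * (ENNReal.ofReal (ε * Real.exp 1 / σ ^ 2) *
          μ (T ⁻¹' optimalBasis I.row I.column)) := by
        refine Finset.sum_le_sum fun I _ => (Finset.sum_le_sum fun k _ => hle I k).trans ?_
        rw [Finset.sum_const, nsmul_eq_mul, Finset.card_univ, Fintype.card_coe]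
        gcongr
        simpa using Finset.card_le_univ I.1.1
    _ = n * ENNReal.ofReal (ε * Real.exp 1 / σ ^ 2) *
          ∑ I : BasisIndex m n, μ (T ⁻¹' optimalBasis I.row I.column) := by
        rw [Finset.mul_sum]
        exact Finset.sum_congr rfl fun I _ => (mul_assoc _ _ _).symm
    _ ≤ n * ENNReal.ofReal (ε * Real.exp 1 / σ ^ 2) * 1 := by gcongr
    _ = ENNReal.ofReal (ε * n * Real.exp 1 / σ ^ 2) := by
        rw [mul_one, ← ENNReal.ofReal_natCast, ← ENNReal.ofReal_mul (Nat.cast_nonneg n)]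
        congr 1
        ring
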